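/- Let $S_{1,1}$ be the once-punctured torus and $\mathcal T(S_{1,1})$ its Teichmüller space, the space of marked complete hyperbolic structures of finite area on $S_{1,1}$. Fix a simple closed geodesic $\gamma$ (that is, the free homotopy class of an essential, non-peripheral simple closed curve) and a simple closed geodesic $\delta$ meeting $\gamma$ exactly once. For $X\in\mathcal T(S_{1,1})$ let $\ell_\gamma(X)$ be the length of $\gamma$ in $X$, and let $\ell_{sys}(X)$ be the length of the shortest closed geodesic of $X$. Say that $X$ has Fenchel–Nielsen coordinates $(L,\tau)$ with respect to $\gamma$ if $\ell_\gamma(X)=L$ and $X$ is obtained by twisting along $\gamma$ by the signed distance $\tau L$ from the structure $X_0$ that has the least $\delta$-length among all structures with $\gamma$-length $L$; thus $\tau=0$ exactly when $\ell_\delta$ is minimal for the given $\ell_\gamma$, and a Dehn twist about $\gamma$ changes $\tau$ by $1$. Let $p,q$ be positive integers with $\gcd(p,q)=1$ and $p/q\in(0,1)$. Then there are functions $C_1,C_2$ of $L$ (depending on $\gamma,\delta,p,q$) with $C_1(L)\to4$ and $C_2(L)\to4$ as $L\to\infty$ such that every $X\in\mathcal T(S_{1,1})$ with Fenchel–Nielsen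 coordinates $(L,p/q)$ with respect to $\gamma$ satisfies $$C_1(L)\,e^{-L/(2q)}<\ell_{sys}(X)<C_2(L)\,e^{-L/(2q)}.$$ -/

import Mathlib

open Filter Topology
open scoped UpperHalfPlane MatrixGroups commutatorElement

namespace PuncturedTorus

/-- The fundamental group of the once-punctured torus `S_{1,1}`, free on two generators
represented by two simple closed curves that meet exactly once. -/
abbrev Pi1 : Type := FreeGroup (Fin 2)

/-- The class of a loop around the puncture: the commutator of the two generators. -/
def peripheral : Pi1 := ⁅(FreeGroup.of 0 : Pi1), FreeGroup.of 1⁆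

/-- `γ` and `δ` represent two simple closed curves on `S_{1,1}` that meet exactly once: they
form a free basis of the fundamental group, and their commutator (the boundary of a regular
neighbourhood of the union of the two curves) is, up to orientation, freely homotopic to the
loop around the puncture. -/
def MeetOnce (γ δ : Pi1) : Prop :=
  (∃ b : FreeGroupBasis (Fin 2) Pi1, b 0 = γ ∧ b 1 = δ) ∧
    (IsConj ⁅γ, δ⁆ peripheral ∨ IsConj ⁅γ, δ⁆ peripheral⁻¹)

/-- A marked complete hyperbolic structure of finite area on `S_{1,1}` (a point of the
Teichmüller space), given by its holonomy: a discrete and faithful representation of the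
fundamental group that sends the loop around the puncture to a parabolic isometry.
Since the group is free, a representation in `PSL(2, ℝ)` lifts to `SL(2, ℝ)`, and discreteness
and faithfulness do not depend on the lift.  Two representations give the same point of the
Teichmüller space when they agree up to signs and conjugation in `GL(2, ℝ)`; everything defined
below is invariant under these changes. -/
structure Teich where
  /-- the holonomy representation -/
  hol : Pi1 →* SL(2, ℝ)
  faithful : Function.Injective hol
  discrete : DiscreteTopology hol.range
  cusp : (hol peripheral : Matrix (Fin 2) (Fin 2) ℝ).IsParabolic

/-- The translation length of an isometry of the hyperbolic plane. -/
noncomputable def translationLength (A : SL(2, ℝ)) : ℝ :=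
  ⨅ z : ℍ, dist z (A • z)

/-- The length `ℓ_g(X)` of the closed geodesic in the free homotopy class of `g`. -/
noncomputable def Teich.len (X : Teich) (g : Pi1) : ℝ :=
  translationLength (X.hol g)

/-- The systole length: the infimum of the lengths of all closed geodesics of `X`. The closed
geodesics are those in the classes with hyperbolic holonomy. -/
noncomputable def Teich.sys (X : Teich) : ℝ :=
  sInf {l : ℝ | ∃ g : Pi1,
    (X.hol g : Matrix (Fin 2) (Fin 2) ℝ).IsHyperbolic ∧ l = X.len g}

/-- The isometry `z ↦ e^t z`, translating by the signed distance `t` along the imaginary axis. -/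
noncomputable def translation (t : ℝ) : SL(2, ℝ) :=
  ⟨!![Real.exp (t / 2), 0; 0, Real.exp (-(t / 2))], by
    rw [Matrix.det_fin_two_of, ← Real.exp_add]; simp⟩

/-- `T` is the translation by the signed distance `t` along the axis of the hyperbolic isometry
`A`, the axis being directed as `A` translates it. -/
def IsAxisTranslation (A : SL(2, ℝ)) (t : ℝ) (T : SL(2, ℝ)) : Prop :=
  ∃ P : SL(2, ℝ),
    (A = P * translation (translationLength A) * P⁻¹ ∨
      A = -(P * translation (translationLength A) * P⁻¹)) ∧
    T = P * translation t * P⁻¹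

/-- `Y` is obtained from `X` by twisting (earthquake) along `γ` by the signed distance `t`.
Cutting along `γ` presents the fundamental group as an HNN extension with stable letter `δ` and
base group generated by `γ` and `δ γ δ⁻¹`; the twist fixes the holonomy of the base and
composes that of `δ` with the translation by `t` along the axis of `γ`.
For `t = ℓ_γ(X)` this is the Dehn twist `δ ↦ δ γ`. -/
def IsTwist (γ δ : Pi1) (X : Teich) (t : ℝ) (Y : Teich) : Prop :=
  ∃ T : SL(2, ℝ), IsAxisTranslation (X.hol γ) t T ∧
    Y.hol γ = X.hol γ ∧ Y.hol δ = X.hol δ * T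

/-- `X` has the least `δ`-length among all hyperbolic structures with the same `γ`-length. -/
def IsUntwisted (γ δ : Pi1) (X : Teich) : Prop :=
  ∀ Y : Teich, Y.len γ = X.len γ → X.len δ ≤ Y.len δ

/-- `X` has Fenchel–Nielsen coordinates `(L, τ)` with respect to `γ`, the twist parameter being
`0` where the length of `δ` is least, and being normalized so that a Dehn twist about `γ` adds
`1` to it: `X` arises from the structure with `γ`-length `L` and twist parameter `0` by
twisting along `γ` by the distance `τ L`. -/
def HasFenchelNielsen (γ δ : Pi1) (X : Teich) (L τ : ℝ) : Prop :=
  X.len γ = L ∧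
    ∃ X₀ : Teich, X₀.len γ = L ∧ IsUntwisted γ δ X₀ ∧ IsTwist γ δ X₀ (τ * L) X

end PuncturedTorus

namespace PuncturedTorus

/-! Put E = exp(L/(2q)). Lengths are functions of traces (`translationLength_eq`), and for two
curves meeting once the traces x, y, z of γ, δ, γδ satisfy Markoff's equation x² + y² + z² = xyz
(`Teich.markoff`). Fenchel–Nielsen coordinates (L, p/q) fix this triple up to signs
(`HasFenchelNielsen.traces`): up to a relative error O(E⁻²) it is (E^q, E^p, E^(p+q)).

Since tr(AB⁻¹) tr(AB) = tr(A)² + tr(B)², passing from (A, B) to (AB⁻¹, B) subtracts one exponent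
from the other. Because gcd(p, q) = 1, Euclid's algorithm ends at generators with exponents (1, 1,
2) (`exists_reduced_pair`). For these, x = tr(AB⁻¹) satisfies (x − 2) tr A tr B = x² + (tr A − tr
B)², so x − 2 ~ 4/E² and the length is asymptotic to √(x² − 4) ~ 4/E
(`exists_mul_lengthOfTrace_close`).

It remains to see that no other hyperbolic class has smaller absolute trace (`abs_tr_of_short`).
Traces of words depend only on the triple (`tr_pairHom_eq`), so they may be computed in a model
group inside the group generated by half-turns about one point on each side of an ideal triangle. A
reduced product of half-turns is, up to sign and rotations, a product of nonnegative matrices, one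
for each left or right turn of a path through the triangle (`word_eq_path`). Closed paths avoiding
side 0 are powers of the short curve; the others, cut at their visits to side 0, are products of
"good" matrices and have trace 2 or at least 9/4 ≥ x (`abs_trace_word`).

The same positivity makes the model group free and discrete, so that every positive Markoff triple
comes from a hyperbolic structure (`exists_teich`). This supplies the competitor that identifies the
structure with τ = 0. -/

/-! ### Translation length in terms of the trace. -/

/-- The length of a closed geodesic whose holonomy has trace `t`. -/
noncomputable def lengthOfTrace (t : ℝ) : ℝ := 2 * Real.arsinh (√(t ^ 2 - 4) / 2)

lemma SL_det_eq (A : SL(2, ℝ)) : A 0 0 * A 1 1 - A 0 1 * A 1 0 = 1 := by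
  have := A.det_coe
  rwa [Matrix.det_fin_two] at this

lemma SL_trace_eq (A : SL(2, ℝ)) : (A : Matrix (Fin 2) (Fin 2) ℝ).trace = A 0 0 + A 1 1 :=
  Matrix.trace_fin_two _

/-- With A = (a, b; c, d), one has z − A•z = (cz² + (d − a)z − b)/(cz + d); the numerator on the
right is the squared modulus of this quadratic. -/
lemma sq_sinh_half_dist_smul (A : SL(2, ℝ)) (z : ℍ) :
    Real.sinh (dist z (A • z) / 2) ^ 2 =
      ((A 1 0 * z.re ^ 2 + (A 1 1 - A 0 0) * z.re - A 0 1 - A 1 0 * z.im ^ 2) ^ 2 +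
        z.im ^ 2 * (2 * A 1 0 * z.re + A 1 1 - A 0 0) ^ 2) / (4 * z.im ^ 2) := by
  have hd := SL_det_eq A
  have hz := z.im_pos
  have hw := (A • z).im_pos
  have hden : (A 1 0 : ℂ) * z + A 1 1 ≠ 0 := by
    intro h
    have hre := congrArg Complex.re h
    have him := congrArg Complex.im h
    simp [hz.ne'] at hre him
    rw [him] at hre
    simp at hre
    rw [him, hre] at hd
    simp at hd
  have hN : 0 < Complex.normSq ((A 1 0 : ℂ) * z + A 1 1) := Complex.normSq_pos.2 hden
  have hco : ((A • z : ℍ) : ℂ) = ((A 0 0 : ℂ) * z + A 0 1) / ((A 1 0 : ℂ) * z + A 1 1) := by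
    have := UpperHalfPlane.coe_specialLinearGroup_apply A z
    simpa using this
  have him : (A • z).im = z.im / Complex.normSq ((A 1 0 : ℂ) * z + A 1 1) := by
    rw [← UpperHalfPlane.coe_im, hco, Complex.div_im, ← sub_div]
    congr 1
    simp
    linear_combination z.im * hd
  rw [UpperHalfPlane.sinh_half_dist, div_pow, mul_pow, Real.sq_sqrt (by positivity)]
  have hdist : dist (z : ℂ) ((A • z : ℍ) : ℂ) ^ 2 =
      Complex.normSq ((A 1 0 : ℂ) * z ^ 2 + (A 1 1 - A 0 0) * z - A 0 1) /
        Complex.normSq ((A 1 0 : ℂ) * z + A 1 1) := by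
    rw [Complex.dist_eq, Complex.sq_norm, hco, ← Complex.normSq_div]
    congr 1
    rw [eq_div_iff hden, sub_mul, div_mul_cancel₀ _ hden]
    ring
  have hnum : Complex.normSq ((A 1 0 : ℂ) * z ^ 2 + (A 1 1 - A 0 0) * z - A 0 1) =
      (A 1 0 * z.re ^ 2 + (A 1 1 - A 0 0) * z.re - A 0 1 - A 1 0 * z.im ^ 2) ^ 2 +
        z.im ^ 2 * (2 * A 1 0 * z.re + A 1 1 - A 0 0) ^ 2 := by
    rw [Complex.normSq_apply]
    simp [pow_two]
    ring
  rw [hdist, him, hnum]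
  field_simp
  ring

/-- The equation is that of the axis of A: a vertical line if c = 0, otherwise a semicircle, whose
top point is the witness. -/
lemma exists_minimal_displacement (A : SL(2, ℝ))
    (h : 4 < (A : Matrix (Fin 2) (Fin 2) ℝ).trace ^ 2) :
    ∃ z : ℍ, A 1 0 * z.re ^ 2 + (A 1 1 - A 0 0) * z.re - A 0 1 = -(A 1 0 * z.im ^ 2) := by
  have hd := SL_det_eq A
  rw [SL_trace_eq] at h
  by_cases hc : A 1 0 = 0
  · have hne : A 1 1 - A 0 0 ≠ 0 := by
      intro h0
      rw [hc] at hd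
      nlinarith
    refine ⟨⟨⟨A 0 1 / (A 1 1 - A 0 0), 1⟩, by simp⟩, ?_⟩
    simp [hc, UpperHalfPlane.re, UpperHalfPlane.im]
    field_simp
    ring
  · set D := (A 0 0 + A 1 1) ^ 2 - 4 with hD
    have hD0 : 0 < D := by linarith
    refine ⟨⟨⟨(A 0 0 - A 1 1) / (2 * A 1 0), √D / (2 * |A 1 0|)⟩, ?_⟩, ?_⟩
    · have := Real.sqrt_pos.2 hD0
      have := abs_pos.2 hc
      simp only
      positivity
    · simp [UpperHalfPlane.re, UpperHalfPlane.im]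
      rw [div_pow √D, Real.sq_sqrt hD0.le, mul_pow, sq_abs]
      field_simp
      rw [hD]
      linear_combination 4 * hd

/-- With z = u + iv and trace t, the displacement formula rearranges to sinh²(dist/2) = (t² − 4)/4 +
(c(u² + v²) + (d − a)u − b)²/(4v²), and the last square vanishes on the axis. -/
theorem translationLength_eq (A : SL(2, ℝ))
    (h : 4 < (A : Matrix (Fin 2) (Fin 2) ℝ).trace ^ 2) :
    translationLength A = lengthOfTrace (A : Matrix (Fin 2) (Fin 2) ℝ).trace := by
  have hd := SL_det_eq A
  have hs : 0 ≤ lengthOfTrace (A : Matrix (Fin 2) (Fin 2) ℝ).trace := by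
    unfold lengthOfTrace
    have : 0 ≤ Real.arsinh (√((A : Matrix (Fin 2) (Fin 2) ℝ).trace ^ 2 - 4) / 2) :=
      Real.arsinh_nonneg_iff.2 (by positivity)
    linarith
  have hsinh : Real.sinh (lengthOfTrace (A : Matrix (Fin 2) (Fin 2) ℝ).trace / 2) ^ 2 =
      ((A : Matrix (Fin 2) (Fin 2) ℝ).trace ^ 2 - 4) / 4 := by
    rw [lengthOfTrace, mul_div_cancel_left₀ _ two_ne_zero, Real.sinh_arsinh, div_pow,
      Real.sq_sqrt (by linarith)]
    norm_num
  have key : ∀ z : ℍ, 0 ≤ Real.sinh (dist z (A • z) / 2) := fun z =>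
    Real.sinh_nonneg_iff.2 (by positivity)
  have hs' : 0 ≤ Real.sinh (lengthOfTrace (A : Matrix (Fin 2) (Fin 2) ℝ).trace / 2) :=
    Real.sinh_nonneg_iff.2 (by linarith)
  apply le_antisymm
  · obtain ⟨z, hz⟩ := exists_minimal_displacement A h
    refine (ciInf_le ⟨0, ?_⟩ z).trans ?_
    · rintro _ ⟨w, rfl⟩
      exact dist_nonneg
    · suffices Real.sinh (dist z (A • z) / 2) ≤
          Real.sinh (lengthOfTrace (A : Matrix (Fin 2) (Fin 2) ℝ).trace / 2) by
        have := Real.sinh_le_sinh.1 this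
        linarith
      rw [← sq_le_sq₀ (key z) hs', hsinh, sq_sinh_half_dist_smul, hz, SL_trace_eq]
      have hy := z.im_pos
      rw [div_le_div_iff₀ (by positivity) (by norm_num)]
      apply le_of_eq
      have hP : A 0 1 = A 1 0 * z.re ^ 2 + (A 1 1 - A 0 0) * z.re + A 1 0 * z.im ^ 2 := by
        linarith
      rw [hP] at hd
      linear_combination (-16) * z.im ^ 2 * hd
  · refine le_ciInf fun z => ?_
    suffices Real.sinh (lengthOfTrace (A : Matrix (Fin 2) (Fin 2) ℝ).trace / 2) ≤
        Real.sinh (dist z (A • z) / 2) by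
      have := Real.sinh_le_sinh.1 this
      linarith
    rw [← sq_le_sq₀ hs' (key z), hsinh, sq_sinh_half_dist_smul, SL_trace_eq]
    have hy := z.im_pos
    rw [div_le_div_iff₀ (by norm_num) (by positivity)]
    have := sq_nonneg (A 1 0 * z.re ^ 2 + (A 1 1 - A 0 0) * z.re - A 0 1 + A 1 0 * z.im ^ 2)
    have e : ((A 0 0 + A 1 1) ^ 2 - 4) = (A 1 1 - A 0 0) ^ 2 + 4 * (A 0 1 * A 1 0) := by
      linear_combination (-4) * (-hd)
    rw [e]
    nlinarith

lemma lengthOfTrace_mono {s t : ℝ} (h : s ^ 2 ≤ t ^ 2) : lengthOfTrace s ≤ lengthOfTrace t := by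
  unfold lengthOfTrace
  have := Real.sqrt_le_sqrt (sub_le_sub_right h 4)
  have := Real.arsinh_le_arsinh.2 (div_le_div_of_nonneg_right this (zero_le_two (α := ℝ)))
  linarith

lemma sq_le_of_lengthOfTrace_le {s t : ℝ} (ht : 4 ≤ t ^ 2)
    (h : lengthOfTrace s ≤ lengthOfTrace t) : s ^ 2 ≤ t ^ 2 := by
  unfold lengthOfTrace at h
  have h1 : Real.arsinh (√(s ^ 2 - 4) / 2) ≤ Real.arsinh (√(t ^ 2 - 4) / 2) := by linarith
  have h2 := Real.arsinh_le_arsinh.1 h1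
  have h3 : √(s ^ 2 - 4) ≤ √(t ^ 2 - 4) := by linarith
  have := (Real.sqrt_le_sqrt_iff (by linarith)).1 h3
  linarith

lemma lengthOfTrace_two_mul_cosh {l : ℝ} (hl : 0 ≤ l) :
    lengthOfTrace (2 * Real.cosh (l / 2)) = l := by
  have h : (2 * Real.cosh (l / 2)) ^ 2 - 4 = (2 * Real.sinh (l / 2)) ^ 2 := by
    rw [mul_pow, Real.cosh_sq]
    ring
  have h0 : 0 ≤ Real.sinh (l / 2) := Real.sinh_nonneg_iff.2 (by linarith)
  rw [lengthOfTrace, h, Real.sqrt_sq (by linarith), mul_div_cancel_left₀ _ two_ne_zero,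
    Real.arsinh_sinh]
  ring

lemma isHyperbolic_iff (A : SL(2, ℝ)) :
    (A : Matrix (Fin 2) (Fin 2) ℝ).IsHyperbolic ↔
      4 < (A : Matrix (Fin 2) (Fin 2) ℝ).trace ^ 2 := by
  rw [Matrix.IsHyperbolic, Matrix.discr_fin_two, A.det_coe]
  constructor <;> intro h <;> linarith

/-! ### Trace identities in SL(2, ℝ). -/

/-- The trace of an element of `SL(2, ℝ)`. -/
def tr (A : SL(2, ℝ)) : ℝ := A 0 0 + A 1 1

lemma trace_eq_tr (A : SL(2, ℝ)) : (A : Matrix (Fin 2) (Fin 2) ℝ).trace = tr A :=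
  SL_trace_eq A

@[simp] lemma tr_one : tr 1 = 2 := by simp [tr]; norm_num

@[simp] lemma tr_neg (A : SL(2, ℝ)) : tr (-A) = -tr A := by simp [tr]; ring

@[simp] lemma tr_inv (A : SL(2, ℝ)) : tr A⁻¹ = tr A := by
  simp [tr, Matrix.SpecialLinearGroup.coe_inv, Matrix.adjugate_fin_two]; ring

lemma tr_mul (A B : SL(2, ℝ)) :
    tr (A * B) = A 0 0 * B 0 0 + A 0 1 * B 1 0 + (A 1 0 * B 0 1 + A 1 1 * B 1 1) := by
  simp [tr, Matrix.mul_apply, Fin.sum_univ_two]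

lemma tr_mul_comm (A B : SL(2, ℝ)) : tr (A * B) = tr (B * A) := by
  rw [tr_mul, tr_mul]; ring

@[simp] lemma tr_conj (P A : SL(2, ℝ)) : tr (P * A * P⁻¹) = tr A := by
  rw [tr_mul_comm]; simp

lemma tr_eq_of_isConj {A B : SL(2, ℝ)} (h : IsConj A B) : tr A = tr B := by
  obtain ⟨c, rfl⟩ := isConj_iff.1 h
  simp

lemma tr_mul_inv (A B : SL(2, ℝ)) : tr (A * B⁻¹) = tr A * tr B - tr (A * B) := by
  rw [tr_mul, tr_mul]
  simp [tr, Matrix.SpecialLinearGroup.coe_inv, Matrix.adjugate_fin_two]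
  ring

lemma tr_mul_eq (A B : SL(2, ℝ)) : tr (A * B) = tr A * tr B - tr (A * B⁻¹) := by
  rw [tr_mul_inv]; ring

/-- Fricke's trace identity. -/
lemma tr_commutator (A B : SL(2, ℝ)) :
    tr ⁅A, B⁆ = tr A ^ 2 + tr B ^ 2 + tr (A * B) ^ 2 - tr A * tr B * tr (A * B) - 2 := by
  have h1 : tr (A * B * (B * A)) = tr (A * A * B) * tr B - tr (A * A) := by
    rw [← mul_assoc, tr_mul_comm, ← mul_assoc, ← mul_assoc, tr_mul_eq, mul_inv_cancel_right]
  have h2 : tr (A * A * B) = tr (A * B) * tr A - tr B := by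
    rw [mul_assoc, tr_mul_comm, tr_mul_eq, tr_mul_comm (A * B), inv_mul_cancel_left]
  have h3 : tr (A * A) = tr A * tr A - 2 := by
    rw [tr_mul_eq, mul_inv_cancel, tr_one]
  rw [commutatorElement_def, mul_assoc, ← mul_inv_rev, tr_mul_inv, tr_mul_comm B A, h1, h2, h3]
  ring

/-! ### The trace of the cusp and Markoff's equation. -/

/-- The commutator is C = 1 + N with N² = 0. As C⁻¹A is conjugate to A, tr(AN) = 0, so A preserves
the kernel of N; hence C and its conjugate by A are unipotents with a common fixed vector. -/
lemma commute_conj_of_tr_commutator_eq_two {A B : SL(2, ℝ)} (h : tr ⁅A, B⁆ = 2) :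
    Commute ⁅A, B⁆ (A * ⁅A, B⁆ * A⁻¹) := by
  set C := ⁅A, B⁆ with hC
  have h1 : tr (A * C⁻¹) = tr A := by
    rw [tr_mul_comm, hC, commutatorElement_inv, commutatorElement_def, inv_mul_cancel_right, tr_conj]
  have hA := SL_det_eq A
  have hC1 := SL_det_eq C
  rw [tr_mul] at h1
  simp only [tr, Matrix.SpecialLinearGroup.coe_inv, Matrix.adjugate_fin_two, Matrix.cons_val',
    Matrix.cons_val_zero, Matrix.cons_val_one, Matrix.of_apply, Matrix.cons_val_fin_one] at h h1
  rw [commute_iff_eq]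
  ext i j
  simp only [Matrix.SpecialLinearGroup.coe_mul, Matrix.SpecialLinearGroup.coe_inv,
    Matrix.adjugate_fin_two, Matrix.mul_apply, Fin.sum_univ_two, Matrix.cons_val',
    Matrix.cons_val_zero, Matrix.cons_val_one, Matrix.of_apply, Matrix.cons_val_fin_one]
  have hd : C 1 1 = 2 - C 0 0 := by linarith
  rw [hd] at hC1 h1
  fin_cases i <;> fin_cases j <;> simp [hd]
  · linear_combination (-((A 0 0 + A 1 1) * (A 1 1 - A 0 0))) * hC1 -
      ((C 0 0 - 1) * A 1 1 - C 0 1 * A 1 0 + (A 0 0 * (C 0 0 - 1) + A 0 1 * C 1 0)) * h1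
  · linear_combination (-((A 0 0 + A 1 1) * (-A 0 1 - A 0 1))) * hC1 -
      ((C 0 0 - 1) * (-A 0 1) + C 0 1 * A 0 0 + (A 0 0 * C 0 1 + A 0 1 * (1 - C 0 0))) * h1
  · linear_combination (-((A 0 0 + A 1 1) * (-A 1 0 - A 1 0))) * hC1 -
      (C 1 0 * A 1 1 + (1 - C 0 0) * (-A 1 0) + (A 1 0 * (C 0 0 - 1) + A 1 1 * C 1 0)) * h1
  · linear_combination (-((A 0 0 + A 1 1) * (A 0 0 - A 1 1))) * hC1 -
      (C 1 0 * (-A 0 1) + (1 - C 0 0) * A 0 0 + (A 1 0 * C 0 1 + A 1 1 * (1 - C 0 0))) * h1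

lemma peripheral_not_commute :
    ¬ Commute peripheral (FreeGroup.of 0 * peripheral * (FreeGroup.of 0)⁻¹) := by
  rw [commute_iff_eq, peripheral]
  decide

/-- Parabolicity leaves ±2; the value 2 would make two elements commute that do not commute in the
free group. -/
lemma Teich.tr_hol_peripheral (X : Teich) : tr (X.hol peripheral) = -2 := by
  have h := X.cusp.2
  rw [Matrix.discr_fin_two, Matrix.SpecialLinearGroup.det_coe, trace_eq_tr] at h
  have h' : (tr (X.hol peripheral) - 2) * (tr (X.hol peripheral) + 2) = 0 := by linarith
  rcases mul_eq_zero.1 h' with h2 | h2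
  · exfalso
    apply peripheral_not_commute
    have hp : X.hol peripheral = ⁅X.hol (FreeGroup.of 0), X.hol (FreeGroup.of 1)⁆ := by
      rw [peripheral, map_commutatorElement]
    have := commute_conj_of_tr_commutator_eq_two (A := X.hol (FreeGroup.of 0))
      (B := X.hol (FreeGroup.of 1)) (by rw [← hp]; linarith)
    rw [← hp, ← map_inv, ← map_mul, ← map_mul] at this
    exact this.of_map X.faithful
  · linarith

lemma Teich.tr_commutator_eq (X : Teich) {γ δ : Pi1} (h : MeetOnce γ δ) :
    tr ⁅X.hol γ, X.hol δ⁆ = -2 := by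
  rw [← map_commutatorElement]
  rcases h.2 with h | h
  · rw [tr_eq_of_isConj (X.hol.map_isConj h), X.tr_hol_peripheral]
  · rw [tr_eq_of_isConj (X.hol.map_isConj h), map_inv, tr_inv, X.tr_hol_peripheral]

lemma Teich.markoff (X : Teich) {γ δ : Pi1} (h : MeetOnce γ δ) :
    tr (X.hol γ) ^ 2 + tr (X.hol δ) ^ 2 + tr (X.hol γ * X.hol δ) ^ 2 =
      tr (X.hol γ) * tr (X.hol δ) * tr (X.hol γ * X.hol δ) := by
  have := X.tr_commutator_eq h
  rw [tr_commutator] at this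
  linarith

/-- If x² ≤ 4, the difference of the two sides is x² + (y − xz/2)² + (1 − x²/4)z² > 0. -/
lemma four_lt_sq_of_markoff {x y z : ℝ} (hx : x ≠ 0) (h : x ^ 2 + y ^ 2 + z ^ 2 = x * y * z) :
    4 < x ^ 2 := by
  by_contra! hle
  have h0 : 0 < x ^ 2 := by positivity
  nlinarith [sq_nonneg (y - x * z / 2), sq_nonneg z]

lemma pow_four_eq_one_of_tr_eq_zero {A : SL(2, ℝ)} (h : tr A = 0) : A ^ 4 = 1 := by
  have hd := SL_det_eq A
  have h2 : A ^ 2 = -1 := by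
    have h1 : A 1 1 = -A 0 0 := by rw [tr] at h; linarith
    rw [h1] at hd
    ext i j
    rw [pow_two]
    fin_cases i <;> fin_cases j <;>
      simp [Matrix.mul_apply, Fin.sum_univ_two, h1] <;> linarith
  rw [show 4 = 2 * 2 from rfl, pow_mul, h2]
  simp

lemma MeetOnce.left_ne_one {γ δ : Pi1} (h : MeetOnce γ δ) : γ ≠ 1 := by
  obtain ⟨⟨b, rfl, -⟩, -⟩ := h
  intro h
  have := congrArg b.repr h
  simp at this

lemma MeetOnce.symm {γ δ : Pi1} (h : MeetOnce γ δ) : MeetOnce δ γ := by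
  obtain ⟨⟨b, rfl, rfl⟩, h⟩ := h
  refine ⟨⟨b.reindex (Equiv.swap 0 1), by simp, by simp⟩, ?_⟩
  have key : ∀ x y : Pi1, IsConj x y → IsConj x⁻¹ y⁻¹ := by
    intro x y hxy
    obtain ⟨c, rfl⟩ := isConj_iff.1 hxy
    exact isConj_iff.2 ⟨c, by group⟩
  rw [← commutatorElement_inv]
  rcases h with h | h
  · exact Or.inr (key _ _ h)
  · exact Or.inl (by simpa using key _ _ h)

/-- Trace zero would give an element of finite order, and free groups are torsion-free. -/
lemma Teich.four_lt_sq_tr (X : Teich) {γ δ : Pi1} (h : MeetOnce γ δ) :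
    4 < tr (X.hol γ) ^ 2 := by
  refine four_lt_sq_of_markoff (fun h0 => ?_) (X.markoff h)
  have h4 := pow_four_eq_one_of_tr_eq_zero h0
  rw [← map_pow] at h4
  have h5 : γ ^ 4 = 1 := X.faithful (by rw [h4, map_one])
  exact h.left_ne_one ((pow_eq_one_iff_left (by norm_num)).1 h5)

lemma Teich.len_eq (X : Teich) {g : Pi1} (h : 4 < tr (X.hol g) ^ 2) :
    X.len g = lengthOfTrace (tr (X.hol g)) := by
  rw [Teich.len, translationLength_eq _ (by rwa [trace_eq_tr]), trace_eq_tr]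

/-! ### Traces of words are determined by three traces. -/

/-- The representation of the free group of rank two that sends the generators to `A` and `B`. -/
def pairHom (A B : SL(2, ℝ)) : FreeGroup (Fin 2) →* SL(2, ℝ) := FreeGroup.lift ![A, B]

lemma cayley_hamilton (A : SL(2, ℝ)) :
    (A * A : Matrix (Fin 2) (Fin 2) ℝ) = tr A • (A : Matrix (Fin 2) (Fin 2) ℝ) - 1 := by
  have hd := SL_det_eq A
  ext i j
  fin_cases i <;> fin_cases j <;> simp [Matrix.mul_apply, Fin.sum_univ_two, tr] <;> linarith

lemma coe_inv_eq (A : SL(2, ℝ)) :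
    ((A⁻¹ : SL(2, ℝ)) : Matrix (Fin 2) (Fin 2) ℝ) = tr A • 1 - (A : Matrix (Fin 2) (Fin 2) ℝ) := by
  ext i j
  fin_cases i <;> fin_cases j <;>
    simp [Matrix.SpecialLinearGroup.coe_inv, Matrix.adjugate_fin_two, tr]

lemma coe_mul_swap (A B : SL(2, ℝ)) :
    (B * A : Matrix (Fin 2) (Fin 2) ℝ) = tr A • (B : Matrix (Fin 2) (Fin 2) ℝ) +
      tr B • (A : Matrix (Fin 2) (Fin 2) ℝ) + (tr (A * B) - tr A * tr B) • 1 -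
        (A * B : Matrix (Fin 2) (Fin 2) ℝ) := by
  rw [tr_mul]
  ext i j
  fin_cases i <;> fin_cases j <;> simp [Matrix.mul_apply, Fin.sum_univ_two, tr] <;> ring

/-- The combination `c 0 + c 1 A + c 2 B + c 3 AB`. -/
def combination (A B : SL(2, ℝ)) (c : Fin 4 → ℝ) : Matrix (Fin 2) (Fin 2) ℝ :=
  c 0 • 1 + c 1 • (A : Matrix (Fin 2) (Fin 2) ℝ) + c 2 • (B : Matrix (Fin 2) (Fin 2) ℝ) +
    c 3 • (A * B : Matrix (Fin 2) (Fin 2) ℝ)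

lemma mul_combination_left (A B : SL(2, ℝ)) (c : Fin 4 → ℝ) :
    (A : Matrix (Fin 2) (Fin 2) ℝ) * combination A B c =
      combination A B ![-c 1, c 0 + tr A * c 1, -c 3, c 2 + tr A * c 3] := by
  have h := cayley_hamilton A
  simp only [combination, mul_add, Matrix.mul_smul, mul_one, ← mul_assoc, h]
  simp [sub_mul, smul_sub, add_smul, smul_smul]
  rw [mul_comm (c 1), mul_comm (c 3)]
  abel

lemma mul_combination_right (A B : SL(2, ℝ)) (c : Fin 4 → ℝ) :
    (B : Matrix (Fin 2) (Fin 2) ℝ) * combination A B c =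
      combination A B ![(tr (A * B) - tr A * tr B) * c 1 - c 2 - tr A * c 3, tr B * c 1 + c 3,
        c 0 + tr A * c 1 + tr B * c 2 + tr (A * B) * c 3, -c 1] := by
  have h := cayley_hamilton B
  have h' := coe_mul_swap A B
  have h'' : (B * A * B : Matrix (Fin 2) (Fin 2) ℝ) =
      A + tr (A * B) • (B : Matrix (Fin 2) (Fin 2) ℝ) - tr A • 1 := by
    rw [h', sub_mul, add_mul, add_mul, mul_assoc, Matrix.smul_mul, Matrix.smul_mul,
      Matrix.smul_mul, h, one_mul, mul_sub, Matrix.mul_smul, mul_one, smul_sub, sub_smul,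
      smul_smul]
    abel
  simp only [combination, mul_add, Matrix.mul_smul, mul_one, ← mul_assoc]
  rw [h'', h', h]
  ext i j
  simp
  ring

lemma inv_mul_combination {A B P : SL(2, ℝ)} {c d : Fin 4 → ℝ}
    (h : (P : Matrix (Fin 2) (Fin 2) ℝ) * combination A B c = combination A B d) :
    ((P⁻¹ : SL(2, ℝ)) : Matrix (Fin 2) (Fin 2) ℝ) * combination A B c =
      combination A B (tr P • c - d) := by
  rw [coe_inv_eq, sub_mul, h, Matrix.smul_mul, one_mul]
  ext i j
  simp [combination]
  ring

/-- The span of 1, A, B, AB is stable under left multiplication by A, B and their inverses, with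
structure constants that involve only the three traces; hence the same coefficients serve both
pairs. -/
lemma exists_combination {A B A' B' : SL(2, ℝ)} (hA : tr A = tr A') (hB : tr B = tr B')
    (hAB : tr (A * B) = tr (A' * B')) (g : FreeGroup (Fin 2)) :
    ∃ c, (pairHom A B g : Matrix (Fin 2) (Fin 2) ℝ) = combination A B c ∧
      (pairHom A' B' g : Matrix (Fin 2) (Fin 2) ℝ) = combination A' B' c := by
  have h0 := mul_combination_left A B
  have h0' := mul_combination_left A' B'
  have h1 := mul_combination_right A B
  have h1' := mul_combination_right A' B'
  rw [← hA] at h0'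
  rw [← hA, ← hB, ← hAB] at h1'
  obtain ⟨l, rfl⟩ : ∃ l, FreeGroup.mk l = g := ⟨g.toWord, FreeGroup.mk_toWord⟩
  induction l with
  | nil =>
    refine ⟨![1, 0, 0, 0], ?_, ?_⟩ <;> simp [combination, ← FreeGroup.one_eq_mk]
  | cons a l ih =>
    obtain ⟨c, hc, hc'⟩ := ih
    have hl : FreeGroup.mk (a :: l) = FreeGroup.mk [a] * FreeGroup.mk l := by
      rw [FreeGroup.mul_mk]; rfl
    obtain ⟨i, b⟩ := a
    rw [hl, map_mul, map_mul, Matrix.SpecialLinearGroup.coe_mul, Matrix.SpecialLinearGroup.coe_mul,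
      hc, hc']
    have e : ∀ P Q : SL(2, ℝ), pairHom P Q (FreeGroup.mk [(0, true)]) = P ∧
        pairHom P Q (FreeGroup.mk [(0, false)]) = P⁻¹ ∧
        pairHom P Q (FreeGroup.mk [(1, true)]) = Q ∧
        pairHom P Q (FreeGroup.mk [(1, false)]) = Q⁻¹ := by
      intro P Q
      simp [pairHom]
    obtain ⟨e1, e2, e3, e4⟩ := e A B
    obtain ⟨e1', e2', e3', e4'⟩ := e A' B'
    have ap : ∀ {M N : SL(2, ℝ)} {Y Z : Matrix (Fin 2) (Fin 2) ℝ}, M = N →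
        (N : Matrix (Fin 2) (Fin 2) ℝ) * Y = Z → (M : Matrix (Fin 2) (Fin 2) ℝ) * Y = Z := by
      rintro M N Y Z rfl h
      exact h
    have i0 := inv_mul_combination (h0' c)
    have i1 := inv_mul_combination (h1' c)
    rw [← hA] at i0
    rw [← hB] at i1
    fin_cases i <;> cases b
    · exact ⟨_, ap e2 (inv_mul_combination (h0 c)), ap e2' i0⟩
    · exact ⟨_, ap e1 (h0 c), ap e1' (h0' c)⟩
    · exact ⟨_, ap e4 (inv_mul_combination (h1 c)), ap e4' i1⟩
    · exact ⟨_, ap e3 (h1 c), ap e3' (h1' c)⟩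

/-- The traces of all words in two matrices are determined by those of the two matrices and
their product. -/
theorem tr_pairHom_eq {A B A' B' : SL(2, ℝ)} (hA : tr A = tr A') (hB : tr B = tr B')
    (hAB : tr (A * B) = tr (A' * B')) (g : FreeGroup (Fin 2)) :
    tr (pairHom A B g) = tr (pairHom A' B' g) := by
  obtain ⟨c, h, h'⟩ := exists_combination hA hB hAB g
  rw [← trace_eq_tr, ← trace_eq_tr, h, h']
  simp only [combination, Matrix.trace_add, Matrix.trace_smul, trace_eq_tr, hA, hB,
    ← Matrix.SpecialLinearGroup.coe_mul, hAB]

/-! ### Half-turns about the sides of an ideal triangle, and turns. -/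

/-- The rotations of the ideal triangle with vertices `0`, `-1`, `∞`, the `j`-th one taking the
side from `0` to `∞` to the `j`-th side. -/
def rot : Fin 3 → Matrix (Fin 2) (Fin 2) ℝ := ![1, !![1, 1; -1, 0], !![0, -1; 1, 1]]

/-- The inverses of the rotations `rot`. -/
def rotInv : Fin 3 → Matrix (Fin 2) (Fin 2) ℝ := ![1, !![0, -1; 1, 1], !![1, 1; -1, 0]]

/-- The half-turn about the point `i s²` of the imaginary axis. -/
noncomputable def flip (s : ℝ) : Matrix (Fin 2) (Fin 2) ℝ := !![0, -s; s⁻¹, 0]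

/-- The half-turn about a point of the `j`-th side of the ideal triangle. -/
noncomputable def halfTurn (s : Fin 3 → ℝ) (j : Fin 3) : Matrix (Fin 2) (Fin 2) ℝ :=
  rot j * flip (s j) * rotInv j

/-- The left turn, crossing the triangle from a side to the next one. -/
noncomputable def leftTurn (s : ℝ) : Matrix (Fin 2) (Fin 2) ℝ := !![s, 0; s⁻¹, s⁻¹]

/-- The right turn, crossing the triangle from a side to the previous one. -/
noncomputable def rightTurn (s : ℝ) : Matrix (Fin 2) (Fin 2) ℝ := !![s, s; 0, s⁻¹]

/-- The turn from the `j`-th to the `k`-th side. -/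
noncomputable def turn (s : Fin 3 → ℝ) (j k : Fin 3) : Matrix (Fin 2) (Fin 2) ℝ :=
  if k = j + 1 then leftTurn (s j) else rightTurn (s j)

/-- The product of half-turns along a list of sides. -/
noncomputable def word (s : Fin 3 → ℝ) (l : List (Fin 3)) : Matrix (Fin 2) (Fin 2) ℝ :=
  (l.map (halfTurn s)).prod

/-- The product of the turns along the path that starts at the `j`-th side. -/
noncomputable def path (s : Fin 3 → ℝ) : Fin 3 → List (Fin 3) → Matrix (Fin 2) (Fin 2) ℝ
  | _, [] => 1
  | j, k :: l => turn s j k * path s k l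

lemma rot_mul_rotInv (j : Fin 3) : rot j * rotInv j = 1 := by
  fin_cases j <;> simp [rot, rotInv, Matrix.one_fin_two]

lemma rotInv_mul_rot (j : Fin 3) : rotInv j * rot j = 1 := by
  fin_cases j <;> simp [rot, rotInv, Matrix.one_fin_two]

lemma flip_mul_flip {s : ℝ} (hs : s ≠ 0) : flip s * flip s = -1 := by
  ext i j
  fin_cases i <;> fin_cases j <;> simp [flip, hs]

lemma halfTurn_mul_self {s : Fin 3 → ℝ} (hs : ∀ j, s j ≠ 0) (j : Fin 3) :
    halfTurn s j * halfTurn s j = -1 := by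
  calc halfTurn s j * halfTurn s j
      = rot j * flip (s j) * (rotInv j * rot j) * flip (s j) * rotInv j := by
        simp only [halfTurn, mul_assoc]
    _ = rot j * (flip (s j) * flip (s j)) * rotInv j := by
        rw [rotInv_mul_rot, mul_one]; simp only [mul_assoc]
    _ = -1 := by rw [flip_mul_flip (hs j), mul_neg, mul_one, neg_mul, rot_mul_rotInv]

lemma flip_mul_rotInv_mul_rot (s : Fin 3 → ℝ) {j k : Fin 3} (h : j ≠ k) :
    flip (s j) * (rotInv j * rot k) = turn s j k ∨
      flip (s j) * (rotInv j * rot k) = -turn s j k := by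
  fin_cases j <;> fin_cases k <;>
    first
      | exact absurd rfl h
      | (left; ext a b; fin_cases a <;> fin_cases b <;>
          simp [flip, rotInv, rot, turn, leftTurn, rightTurn]; done)
      | (right; ext a b; fin_cases a <;> fin_cases b <;>
          simp [flip, rotInv, rot, turn, leftTurn, rightTurn])

@[simp] lemma word_nil (s : Fin 3 → ℝ) : word s [] = 1 := by simp [word]

@[simp] lemma word_cons (s : Fin 3 → ℝ) (j : Fin 3) (l : List (Fin 3)) :
    word s (j :: l) = halfTurn s j * word s l := by simp [word]

@[simp] lemma word_append (s : Fin 3 → ℝ) (l m : List (Fin 3)) :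
    word s (l ++ m) = word s l * word s m := by simp [word]

lemma eq_or_eq_neg_mul {P Q P' Q' : Matrix (Fin 2) (Fin 2) ℝ} (h : P = Q ∨ P = -Q)
    (h' : P' = Q' ∨ P' = -Q') : P * P' = Q * Q' ∨ P * P' = -(Q * Q') := by
  rcases h with rfl | rfl <;> rcases h' with rfl | rfl <;> simp

/-- A product of half-turns along a reduced list is a product of turns, up to rotations. -/
lemma word_eq_path (s : Fin 3 → ℝ) (j : Fin 3) (l : List (Fin 3))
    (h : List.IsChain (· ≠ ·) (j :: l)) :
    ∃ k, k = (j :: l).getLast (by simp) ∧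
    (rotInv j * word s (j :: l) = path s j l * (flip (s k) * rotInv k) ∨
      rotInv j * word s (j :: l) = -(path s j l * (flip (s k) * rotInv k))) := by
  induction l generalizing j with
  | nil =>
    refine ⟨j, rfl, Or.inl ?_⟩
    simp only [word_cons, word_nil, halfTurn, path, mul_one, one_mul]
    rw [mul_assoc, ← mul_assoc, rotInv_mul_rot, one_mul]
  | cons i l ih =>
    rw [List.isChain_cons_cons] at h
    obtain ⟨k, hk, h'⟩ := ih i h.2
    refine ⟨k, by simpa using hk, ?_⟩
    have e : rotInv j * word s (j :: i :: l) =
        flip (s j) * (rotInv j * rot i) * (rotInv i * word s (i :: l)) := by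
      calc rotInv j * word s (j :: i :: l)
          = (rotInv j * rot j) * flip (s j) * rotInv j * (rot i * rotInv i) *
              word s (i :: l) := by
            rw [rot_mul_rotInv, mul_one]
            simp only [word_cons, halfTurn, mul_assoc]
        _ = _ := by
            rw [rotInv_mul_rot, one_mul]
            simp only [mul_assoc]
    rw [e, path, mul_assoc (turn s j i)]
    exact eq_or_eq_neg_mul (flip_mul_rotInv_mul_rot s h.1) h'

/-- Entrywise nonnegativity. -/
def Nonneg (M : Matrix (Fin 2) (Fin 2) ℝ) : Prop := ∀ i j, 0 ≤ M i j

lemma Nonneg.mul {M N : Matrix (Fin 2) (Fin 2) ℝ} (hM : Nonneg M) (hN : Nonneg N) :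
    Nonneg (M * N) := by
  intro i j
  rw [Matrix.mul_apply]
  exact Finset.sum_nonneg fun k _ => mul_nonneg (hM i k) (hN k j)

lemma nonneg_one : Nonneg 1 := by
  intro i j
  fin_cases i <;> fin_cases j <;> simp

lemma nonneg_turn {s : Fin 3 → ℝ} (hs : ∀ j, 0 < s j) (j k : Fin 3) : Nonneg (turn s j k) := by
  intro a b
  have := hs j
  unfold turn
  split_ifs <;> fin_cases a <;> fin_cases b <;> simp [leftTurn, rightTurn] <;> positivity

lemma nonneg_path {s : Fin 3 → ℝ} (hs : ∀ j, 0 < s j) (j : Fin 3) (l : List (Fin 3)) :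
    Nonneg (path s j l) := by
  induction l generalizing j with
  | nil => exact nonneg_one
  | cons k l ih => exact (nonneg_turn hs j k).mul (ih k)

/-! ### The model group is free and discrete. -/

/-- A neighbourhood of the identity that meets no nontrivial reduced product of half-turns. -/
def signNhd (s : Fin 3 → ℝ) : Set (Matrix (Fin 2) (Fin 2) ℝ) :=
  {M | ∀ j k, ∃ a b c d, (rotInv j * M * rot k * flip (s k)) a b *
    (rotInv j * M * rot k * flip (s k)) c d < 0}

lemma isOpen_signNhd (s : Fin 3 → ℝ) : IsOpen (signNhd s) := by
  simp only [signNhd, Set.ofPred_forall, Set.ofPred_exists]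
  refine isOpen_iInter_of_finite fun j => isOpen_iInter_of_finite fun k => ?_
  refine isOpen_iUnion fun a => isOpen_iUnion fun b => isOpen_iUnion fun c => isOpen_iUnion fun d => ?_
  refine isOpen_lt ?_ continuous_const
  have h : Continuous fun M : Matrix (Fin 2) (Fin 2) ℝ => rotInv j * M * rot k * flip (s k) := by
    fun_prop
  exact (h.matrix_elem a b).mul (h.matrix_elem c d)

lemma one_mem_signNhd {s : Fin 3 → ℝ} (hs : ∀ j, 0 < s j) : 1 ∈ signNhd s := by
  intro j k
  have h0 := hs 0
  have h1 := hs 1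
  have h2 := hs 2
  fin_cases j <;> fin_cases k <;>
    first
      | (refine ⟨0, 0, 0, 1, ?_⟩; simp [rot, rotInv, flip, *]; done)
      | (refine ⟨0, 0, 1, 0, ?_⟩; simp [rot, rotInv, flip, *]; done)
      | (refine ⟨0, 1, 1, 0, ?_⟩; simp [rot, rotInv, flip, *])

lemma neg_mem_signNhd {s : Fin 3 → ℝ} {M : Matrix (Fin 2) (Fin 2) ℝ} :
    -M ∈ signNhd s ↔ M ∈ signNhd s := by
  simp [signNhd]

/-- After the multiplications in `signNhd`, a reduced word becomes plus or minus a product of turns,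
whose entries all have one sign. -/
lemma word_notMem_signNhd {s : Fin 3 → ℝ} (hs : ∀ j, 0 < s j) {l : List (Fin 3)} (hl : l ≠ [])
    (h : List.IsChain (· ≠ ·) l) : word s l ∉ signNhd s := by
  obtain ⟨j, l, rfl⟩ := List.exists_cons_of_ne_nil hl
  obtain ⟨k, -, h'⟩ := word_eq_path s j l h
  intro hmem
  obtain ⟨a, b, c, d, hlt⟩ := hmem j k
  have e : path s j l * (flip (s k) * rotInv k) * rot k * flip (s k) = -path s j l := by
    rw [mul_assoc, mul_assoc, mul_assoc, ← mul_assoc (rotInv k), rotInv_mul_rot, one_mul,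
      flip_mul_flip (hs k).ne', mul_neg, mul_one]
  have hn := nonneg_path hs j l
  have := mul_nonneg (hn a b) (hn c d)
  rcases h' with h' | h' <;> rw [h'] at hlt <;> simp [e] at hlt <;> linarith

lemma det_halfTurn {s : Fin 3 → ℝ} (hs : ∀ j, 0 < s j) (j : Fin 3) : (halfTurn s j).det = 1 := by
  have := (hs j).ne'
  have h : (rot j).det * (rotInv j).det = 1 := by
    rw [← Matrix.det_mul, rot_mul_rotInv, Matrix.det_one]
  rw [halfTurn, Matrix.det_mul, Matrix.det_mul, mul_right_comm, h]
  simp [flip, Matrix.det_fin_two, this]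

/-- The first generator of the group generated by products of two half-turns. -/
noncomputable def modelLeft (s : Fin 3 → ℝ) (hs : ∀ j, 0 < s j) : SL(2, ℝ) :=
  ⟨-(halfTurn s 1 * halfTurn s 2), by simp [Matrix.det_neg, det_halfTurn hs]⟩

/-- The second generator of the group generated by products of two half-turns. -/
noncomputable def modelRight (s : Fin 3 → ℝ) (hs : ∀ j, 0 < s j) : SL(2, ℝ) :=
  ⟨-(halfTurn s 2 * halfTurn s 0), by simp [Matrix.det_neg, det_halfTurn hs]⟩

/-- The list of two sides that gives a letter of the free group. -/
def letterList : Fin 2 × Bool → List (Fin 3)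
  | (0, true) => [1, 2]
  | (0, false) => [2, 1]
  | (1, true) => [2, 0]
  | (1, false) => [0, 2]

lemma coe_inv_model {s : Fin 3 → ℝ} (hs : ∀ j, 0 < s j) {j k : Fin 3} {M : SL(2, ℝ)}
    (h : (M : Matrix (Fin 2) (Fin 2) ℝ) = -(halfTurn s j * halfTurn s k)) :
    ((M⁻¹ : SL(2, ℝ)) : Matrix (Fin 2) (Fin 2) ℝ) = -(halfTurn s k * halfTurn s j) := by
  have hne : ∀ j, s j ≠ 0 := fun j => (hs j).ne'
  have h1 : (M : Matrix (Fin 2) (Fin 2) ℝ) * -(halfTurn s k * halfTurn s j) = 1 := by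
    rw [h, neg_mul_neg, mul_assoc, ← mul_assoc (halfTurn s k), halfTurn_mul_self hne, neg_one_mul,
      mul_neg, halfTurn_mul_self hne, neg_neg]
  have h2 : ((M⁻¹ : SL(2, ℝ)) : Matrix (Fin 2) (Fin 2) ℝ) * M = 1 := by
    rw [← Matrix.SpecialLinearGroup.coe_mul, inv_mul_cancel, Matrix.SpecialLinearGroup.coe_one]
  calc _ = ((M⁻¹ : SL(2, ℝ)) : Matrix (Fin 2) (Fin 2) ℝ) * (M * -(halfTurn s k * halfTurn s j)) := by
        rw [h1, mul_one]
    _ = _ := by rw [← mul_assoc, h2, one_mul]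

lemma pairHom_letter {s : Fin 3 → ℝ} (hs : ∀ j, 0 < s j) (x : Fin 2 × Bool) :
    (pairHom (modelLeft s hs) (modelRight s hs) (FreeGroup.mk [x]) : Matrix (Fin 2) (Fin 2) ℝ) =
      -word s (letterList x) := by
  obtain ⟨i, b⟩ := x
  fin_cases i <;> cases b
  · have : pairHom (modelLeft s hs) (modelRight s hs) (FreeGroup.mk [(0, false)]) =
      (modelLeft s hs)⁻¹ := by simp [pairHom]
    exact (congrArg _ this).trans ((coe_inv_model hs rfl).trans (by simp [letterList]))
  · simp [pairHom, modelLeft, letterList]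
    rfl
  · have : pairHom (modelLeft s hs) (modelRight s hs) (FreeGroup.mk [(1, false)]) =
      (modelRight s hs)⁻¹ := by simp [pairHom]
    exact (congrArg _ this).trans ((coe_inv_model hs rfl).trans (by simp [letterList]))
  · simp [pairHom, modelRight, letterList]
    rfl

/-- What is known about the first two sides of the list of a reduced word that begins with a given
letter. -/
def StartsWith : Fin 2 × Bool → List (Fin 3) → Prop
  | (0, true), l => ∃ k t, l = 1 :: k :: t
  | (0, false), l => ∃ t, l = 2 :: 1 :: t
  | (1, true), l => ∃ t, l = 2 :: 0 :: t
  | (1, false), l => ∃ k t, l = 0 :: k :: t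

lemma StartsWith.ne_nil {x : Fin 2 × Bool} {l : List (Fin 3)} (h : StartsWith x l) : l ≠ [] := by
  rintro rfl
  obtain ⟨i, b⟩ := x
  fin_cases i <;> cases b <;> simp [StartsWith] at h

lemma word_cancel {s : Fin 3 → ℝ} (hs : ∀ j, 0 < s j) (l m : List (Fin 3)) (j : Fin 3) :
    word s (l ++ j :: j :: m) = -word s (l ++ m) := by
  have hne : ∀ j, s j ≠ 0 := fun j => (hs j).ne'
  rw [word_append, word_cons, word_cons, ← mul_assoc (halfTurn s j), halfTurn_mul_self hne,
    word_append]
  simp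

/-- A cancellation occurs only if the list of x ends in 2 and that of y begins with 2. The second
side for y, recorded by `StartsWith`, then differs from the first side for x, so exactly one pair
cancels. -/
lemma exists_list_letter_append {s : Fin 3 → ℝ} (hs : ∀ j, 0 < s j) {x y : Fin 2 × Bool}
    (hxy : x.1 = y.1 → x.2 = y.2) {l : List (Fin 3)} (hl : List.IsChain (· ≠ ·) l)
    (hy : StartsWith y l) :
    ∃ m, List.IsChain (· ≠ ·) m ∧ StartsWith x m ∧
      (word s (letterList x ++ l) = word s m ∨ word s (letterList x ++ l) = -word s m) := by
  obtain ⟨i, b⟩ := x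
  obtain ⟨i', b'⟩ := y
  have cancel := word_cancel hs
  fin_cases i <;> cases b <;> fin_cases i' <;> cases b' <;> simp at hxy <;>
    simp only [StartsWith] at hy <;>
    obtain ⟨k, t, rfl⟩ := hy
  all_goals
    simp only [letterList, StartsWith, List.cons_append, List.nil_append]
    first
      | exact ⟨_, List.isChain_cons_cons.2 ⟨by decide, List.isChain_cons_cons.2 ⟨by decide, hl⟩⟩,
          ⟨_, rfl⟩, Or.inl rfl⟩
      | exact ⟨_, List.isChain_cons_cons.2 ⟨by decide, List.isChain_cons_cons.2 ⟨by decide, hl⟩⟩,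
          ⟨_, _, rfl⟩, Or.inl rfl⟩
      | exact ⟨_, List.isChain_cons_cons.2 ⟨by decide, (List.isChain_cons_cons.1 hl).2⟩,
          ⟨_, _, rfl⟩, Or.inr (cancel [_] _ _)⟩

lemma exists_list_of_isReduced {s : Fin 3 → ℝ} (hs : ∀ j, 0 < s j) (w : List (Fin 2 × Bool))
    (x : Fin 2 × Bool) (h : FreeGroup.IsReduced (x :: w)) :
    ∃ l, List.IsChain (· ≠ ·) l ∧ StartsWith x l ∧
      ((pairHom (modelLeft s hs) (modelRight s hs) (FreeGroup.mk (x :: w)) :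
          Matrix (Fin 2) (Fin 2) ℝ) = word s l ∨
        (pairHom (modelLeft s hs) (modelRight s hs) (FreeGroup.mk (x :: w)) :
          Matrix (Fin 2) (Fin 2) ℝ) = -word s l) := by
  induction w generalizing x with
  | nil =>
    refine ⟨letterList x, ?_, ?_, Or.inr (pairHom_letter hs x)⟩
    · obtain ⟨i, b⟩ := x
      fin_cases i <;> cases b <;> simp [letterList]
    · obtain ⟨i, b⟩ := x
      fin_cases i <;> cases b <;> simp [letterList, StartsWith]
  | cons y w ih =>
    rw [FreeGroup.isReduced_cons_cons] at h
    obtain ⟨l, hl, hy, e⟩ := ih y h.2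
    obtain ⟨m, hm, hx, e'⟩ := exists_list_letter_append hs h.1 hl hy
    refine ⟨m, hm, hx, ?_⟩
    have hsplit : FreeGroup.mk (x :: y :: w) = FreeGroup.mk [x] * FreeGroup.mk (y :: w) := by
      rw [FreeGroup.mul_mk]; rfl
    rw [hsplit, map_mul, Matrix.SpecialLinearGroup.coe_mul, pairHom_letter]
    rw [word_append] at e'
    rcases e with e | e <;> rw [e] <;> rcases e' with e' | e' <;> simp [e']

lemma exists_list_pairHom {s : Fin 3 → ℝ} (hs : ∀ j, 0 < s j) (g : FreeGroup (Fin 2)) :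
    ∃ l, List.IsChain (· ≠ ·) l ∧ (g ≠ 1 → l ≠ []) ∧
      ((pairHom (modelLeft s hs) (modelRight s hs) g : Matrix (Fin 2) (Fin 2) ℝ) = word s l ∨
        (pairHom (modelLeft s hs) (modelRight s hs) g : Matrix (Fin 2) (Fin 2) ℝ) =
          -word s l) := by
  have hred : FreeGroup.IsReduced g.toWord := FreeGroup.isReduced_toWord
  have hmk : FreeGroup.mk g.toWord = g := FreeGroup.mk_toWord
  rcases hw : g.toWord with - | ⟨x, w⟩
  · have hg : g = 1 := by rw [← hmk, hw, FreeGroup.one_eq_mk]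
    subst hg
    exact ⟨[], by simp, by simp, by simp⟩
  · rw [hw] at hred hmk
    obtain ⟨l, hl, hx, e⟩ := exists_list_of_isReduced hs w x hred
    rw [hmk] at e
    exact ⟨l, hl, fun _ => hx.ne_nil, e⟩

lemma pairHom_model_notMem {s : Fin 3 → ℝ} (hs : ∀ j, 0 < s j) {g : FreeGroup (Fin 2)}
    (hg : g ≠ 1) :
    (pairHom (modelLeft s hs) (modelRight s hs) g : Matrix (Fin 2) (Fin 2) ℝ) ∉ signNhd s := by
  obtain ⟨l, hl, hne, e⟩ := exists_list_pairHom hs g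
  have := word_notMem_signNhd hs (hne hg) hl
  rcases e with e | e <;> rw [e]
  · exact this
  · rwa [neg_mem_signNhd]

lemma pairHom_model_injective {s : Fin 3 → ℝ} (hs : ∀ j, 0 < s j) :
    Function.Injective (pairHom (modelLeft s hs) (modelRight s hs)) := by
  rw [injective_iff_map_eq_one]
  intro g hg
  by_contra hne
  apply pairHom_model_notMem hs hne
  rw [hg]
  exact one_mem_signNhd hs

lemma pairHom_model_discrete {s : Fin 3 → ℝ} (hs : ∀ j, 0 < s j) :
    DiscreteTopology (pairHom (modelLeft s hs) (modelRight s hs)).range := by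
  apply discreteTopology_of_isOpen_singleton_one
  have hcont : Continuous fun M : (pairHom (modelLeft s hs) (modelRight s hs)).range =>
      ((M : SL(2, ℝ)) : Matrix (Fin 2) (Fin 2) ℝ) :=
    continuous_subtype_val.comp continuous_subtype_val
  convert (isOpen_signNhd s).preimage hcont
  ext M
  obtain ⟨M, g, rfl⟩ := M
  simp only [Set.mem_singleton_iff, Set.mem_preimage]
  constructor
  · intro h
    have h' : pairHom (modelLeft s hs) (modelRight s hs) g = 1 := congrArg Subtype.val h
    rw [h']
    exact one_mem_signNhd hs
  · intro h
    have hg : g = 1 := by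
      by_contra hne
      exact pairHom_model_notMem hs hne h
    subst hg
    ext1
    simp

/-! ### Realizing Markoff triples by hyperbolic structures. -/

/-- The parameters of the half-turns of the structure with a given triple of traces. -/
noncomputable def sides (x y z : ℝ) : Fin 3 → ℝ := ![y / z, z / x, x / y]

lemma sides_pos {x y z : ℝ} (hx : 0 < x) (hy : 0 < y) (hz : 0 < z) (j : Fin 3) :
    0 < sides x y z j := by
  fin_cases j <;> simp [sides] <;> positivity

lemma tr_model {x y z : ℝ} (hx : 0 < x) (hy : 0 < y) (hz : 0 < z)
    (h : x ^ 2 + y ^ 2 + z ^ 2 = x * y * z) :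
    tr (modelLeft (sides x y z) (sides_pos hx hy hz)) = x ∧
      tr (modelRight (sides x y z) (sides_pos hx hy hz)) = y ∧
      tr (modelLeft (sides x y z) (sides_pos hx hy hz) *
        modelRight (sides x y z) (sides_pos hx hy hz)) = z := by
  have hne : ∀ j, sides x y z j ≠ 0 := fun j => (sides_pos hx hy hz j).ne'
  refine ⟨?_, ?_, ?_⟩
  · simp [tr, modelLeft, halfTurn, rot, rotInv, flip, sides]
    field_simp
    linear_combination x ^ 2 * h
  · simp [tr, modelRight, halfTurn, rot, rotInv, flip, sides]
    field_simp
    linarith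
  · rw [← trace_eq_tr, Matrix.SpecialLinearGroup.coe_mul]
    simp only [modelLeft, modelRight, neg_mul_neg]
    rw [mul_assoc, ← mul_assoc (halfTurn _ 2), halfTurn_mul_self hne]
    simp [Matrix.trace_fin_two, halfTurn, rot, rotInv, flip, sides]
    field_simp
    linarith

lemma peripheral_not_commute_of : ¬ Commute peripheral (FreeGroup.of 0) := by
  rw [commute_iff_eq, peripheral]
  decide

/-- Every Markoff triple is the triple of traces of a hyperbolic structure. -/
theorem exists_teich {γ δ : Pi1} (hγδ : MeetOnce γ δ) {x y z : ℝ} (hx : 0 < x) (hy : 0 < y)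
    (hz : 0 < z) (h : x ^ 2 + y ^ 2 + z ^ 2 = x * y * z) :
    ∃ Y : Teich, tr (Y.hol γ) = x ∧ tr (Y.hol δ) = y := by
  obtain ⟨hA, hB, hAB⟩ := tr_model hx hy hz h
  have hinj := pairHom_model_injective (sides_pos hx hy hz)
  have hdisc := pairHom_model_discrete (sides_pos hx hy hz)
  set A := modelLeft (sides x y z) (sides_pos hx hy hz)
  set B := modelRight (sides x y z) (sides_pos hx hy hz)
  obtain ⟨⟨b, rfl, rfl⟩, hconj⟩ := hγδ
  set ρ : Pi1 →* SL(2, ℝ) := (pairHom A B).comp b.repr.toMonoidHom with hρ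
  have hρi : Function.Injective ρ := hinj.comp b.repr.injective
  have hρ0 : ρ (b 0) = A := by simp [hρ, pairHom]
  have hρ1 : ρ (b 1) = B := by simp [hρ, pairHom]
  have hrange : ρ.range = (pairHom A B).range := by
    ext M
    constructor
    · rintro ⟨g, rfl⟩
      exact ⟨b.repr g, rfl⟩
    · rintro ⟨g, rfl⟩
      exact ⟨b.repr.symm g, by simp [hρ]⟩
  have htr : tr (ρ peripheral) = -2 := by
    have e : tr (ρ ⁅b 0, b 1⁆) = -2 := by
      rw [map_commutatorElement, hρ0, hρ1, tr_commutator, hA, hB, hAB]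
      linarith
    rcases hconj with hc | hc
    · rw [← tr_eq_of_isConj (ρ.map_isConj hc), e]
    · have := tr_eq_of_isConj (ρ.map_isConj hc)
      rw [map_inv, tr_inv] at this
      rw [← this, e]
  refine ⟨⟨ρ, hρi, hrange ▸ hdisc, ?_, ?_⟩, ?_, ?_⟩
  -- A scalar image would be central, while the peripheral element does not commute with a
  -- generator.
  · rintro ⟨c, hc⟩
    apply peripheral_not_commute_of
    apply Commute.of_map hρi
    rw [commute_iff_eq]
    apply Subtype.ext
    rw [Matrix.SpecialLinearGroup.coe_mul, Matrix.SpecialLinearGroup.coe_mul, ← hc]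
    exact (Matrix.scalar_commute c (fun r => mul_comm c r) _).eq
  · rw [Matrix.discr_fin_two, Matrix.SpecialLinearGroup.det_coe, trace_eq_tr, htr]
    norm_num
  · rw [hρ0, hA]
  · rw [hρ1, hB]

/-! ### From Fenchel–Nielsen coordinates to traces. -/

lemma tr_mul_translation (A : SL(2, ℝ)) (t : ℝ) :
    tr (A * translation t) = A 0 0 * Real.exp (t / 2) + A 1 1 * Real.exp (-(t / 2)) := by
  rw [tr_mul]
  simp [translation]

lemma translation_mul_translation (s t : ℝ) :
    translation s * translation t = translation (s + t) := by
  apply Subtype.ext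
  rw [Matrix.SpecialLinearGroup.coe_mul]
  ext i j
  fin_cases i <;> fin_cases j <;> simp [translation, ← Real.exp_add] <;> ring_nf

lemma Teich.len_pos (X : Teich) {γ δ : Pi1} (h : MeetOnce γ δ) : 0 < X.len γ := by
  have h4 := X.four_lt_sq_tr h
  rw [X.len_eq h4, lengthOfTrace]
  have : 0 < Real.arsinh (√(tr (X.hol γ) ^ 2 - 4) / 2) :=
    Real.arsinh_pos_iff.2 (by have := Real.sqrt_pos.2 (sub_pos.2 h4); positivity)
  linarith

/-- The diagonal entries of `δ` in the coordinates where `γ` is diagonal. -/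
lemma diag_mul_diag_eq {L a d : ℝ} (hL : 0 < L)
    (h : (2 * Real.cosh (L / 2)) ^ 2 + (a + d) ^ 2 +
      (a * Real.exp (L / 2) + d * Real.exp (-(L / 2))) ^ 2 =
        2 * Real.cosh (L / 2) * (a + d) * (a * Real.exp (L / 2) + d * Real.exp (-(L / 2)))) :
    a * d = (Real.cosh (L / 2) / Real.sinh (L / 2)) ^ 2 := by
  have hs : 0 < Real.sinh (L / 2) := Real.sinh_pos_iff.2 (by linarith)
  have h1 : Real.exp (L / 2) = Real.cosh (L / 2) + Real.sinh (L / 2) :=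
    (Real.cosh_add_sinh _).symm
  have h2 : Real.exp (-(L / 2)) = Real.cosh (L / 2) - Real.sinh (L / 2) :=
    (Real.cosh_sub_sinh _).symm
  have h3 := Real.cosh_sq (L / 2)
  rw [h1, h2] at h
  rw [div_pow, eq_div_iff (by positivity)]
  linear_combination (-1 / 4) * h + (-1 / 4) * (a + d) ^ 2 * h3

/-- The competitor comes from the symmetric Markoff triple, the one with xy = 2z, where the traces
of γδ and γδ⁻¹ agree. -/
lemma IsUntwisted.sq_tr_le {γ δ : Pi1} (hγδ : MeetOnce γ δ) {X : Teich}
    (h : IsUntwisted γ δ X) :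
    tr (X.hol δ) ^ 2 ≤ 4 * (Real.cosh (X.len γ / 2) / Real.sinh (X.len γ / 2)) ^ 2 := by
  have hL := X.len_pos hγδ
  set L := X.len γ with hLdef
  have hs : 0 < Real.sinh (L / 2) := Real.sinh_pos_iff.2 (by linarith)
  have hc : 0 < Real.cosh (L / 2) := Real.cosh_pos _
  have h3 := Real.cosh_sq (L / 2)
  obtain ⟨Y, hY, hY'⟩ := exists_teich hγδ (x := 2 * Real.cosh (L / 2))
    (y := 2 * (Real.cosh (L / 2) / Real.sinh (L / 2)))
    (z := 2 * Real.cosh (L / 2) * (Real.cosh (L / 2) / Real.sinh (L / 2)))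
    (by positivity) (by positivity) (by positivity) (by
      field_simp
      linear_combination (-1) * h3)
  have hYγ : Y.len γ = L := by
    rw [Y.len_eq (Y.four_lt_sq_tr hγδ), hY, lengthOfTrace_two_mul_cosh hL.le]
  have hle := h Y hYγ
  have h4 := Y.four_lt_sq_tr hγδ.symm
  rw [Y.len_eq h4, X.len_eq (X.four_lt_sq_tr hγδ.symm)] at hle
  have := sq_le_of_lengthOfTrace_le h4.le hle
  rw [hY'] at this
  linarith

/-- The traces of a structure with Fenchel–Nielsen coordinates `(L, τ)`. -/
theorem HasFenchelNielsen.traces {γ δ : Pi1} (hγδ : MeetOnce γ δ) {X : Teich} {L τ : ℝ}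
    (h : HasFenchelNielsen γ δ X L τ) :
    ∃ A B : SL(2, ℝ), (X.hol γ = A ∨ X.hol γ = -A) ∧ (X.hol δ = B ∨ X.hol δ = -B) ∧
      tr A = 2 * Real.cosh (L / 2) ∧
      tr B = 2 * (Real.cosh (L / 2) / Real.sinh (L / 2)) * Real.cosh (τ * L / 2) ∧
      tr (A * B) = 2 * (Real.cosh (L / 2) / Real.sinh (L / 2)) * Real.cosh ((τ * L + L) / 2) := by
  obtain ⟨-, X₀, hX₀, hunt, T, ⟨P, hP, hT⟩, hXγ, hXδ⟩ := h
  have hL : 0 < L := hX₀ ▸ X₀.len_pos hγδ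
  have hle := hunt.sq_tr_le hγδ
  rw [hX₀] at hle
  have hlen : translationLength (X₀.hol γ) = L := hX₀
  rw [hlen] at hP
  set k := Real.cosh (L / 2) / Real.sinh (L / 2) with hk
  have hkpos : 0 < k := div_pos (Real.cosh_pos _) (Real.sinh_pos_iff.2 (by linarith))
  set A := P * translation L * P⁻¹ with hA
  set B₁ := P⁻¹ * X₀.hol δ * P with hB₁
  have hδ : X₀.hol δ = P * B₁ * P⁻¹ := by rw [hB₁]; group
  have htrA : tr A = 2 * Real.cosh (L / 2) := by
    rw [hA, tr_conj, ← one_mul (translation L), tr_mul_translation, Real.cosh_eq]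
    simp
    ring
  have htrB : tr (X₀.hol δ) = B₁ 0 0 + B₁ 1 1 := by
    rw [hδ, tr_conj, tr]
  have htrAB : tr (A * X₀.hol δ) =
      B₁ 0 0 * Real.exp (L / 2) + B₁ 1 1 * Real.exp (-(L / 2)) := by
    have e : A * X₀.hol δ = P * (translation L * B₁) * P⁻¹ := by rw [hA, hδ]; group
    rw [e, tr_conj, tr_mul_comm, tr_mul_translation]
  have hmark := X₀.markoff hγδ
  have hmark' : tr A ^ 2 + tr (X₀.hol δ) ^ 2 + tr (A * X₀.hol δ) ^ 2 =
      tr A * tr (X₀.hol δ) * tr (A * X₀.hol δ) := by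
    rcases hP with e | e <;> rw [e] at hmark
    · exact hmark
    · simp only [neg_mul, tr_neg] at hmark
      linarith
  rw [htrA, htrB, htrAB] at hmark'
  have had := diag_mul_diag_eq hL hmark'
  rw [htrB] at hle
  -- Minimality gives (a + d)² ≤ 4 coth²(L/2) = 4ad for the diagonal entries a, d, which forces a =
  -- d.
  have heq : B₁ 0 0 = B₁ 1 1 := by
    have : (B₁ 0 0 - B₁ 1 1) ^ 2 ≤ 0 := by nlinarith
    have := pow_eq_zero_iff (two_ne_zero) |>.1 (le_antisymm this (sq_nonneg _))
    linarith
  have hsign : B₁ 0 0 = k ∨ B₁ 0 0 = -k := by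
    rw [← heq, ← pow_two] at had
    exact sq_eq_sq_iff_eq_or_eq_neg.1 had
  have e1 : X.hol δ = P * (B₁ * translation (τ * L)) * P⁻¹ := by
    rw [hXδ, hδ, hT]; group
  have e2 : A * X.hol δ = P * (translation L * (B₁ * translation (τ * L))) * P⁻¹ := by
    rw [e1, hA]; group
  have t1 : tr (X.hol δ) = 2 * B₁ 0 0 * Real.cosh (τ * L / 2) := by
    rw [e1, tr_conj, tr_mul_translation, ← heq, Real.cosh_eq]
    ring
  have t2 : tr (A * X.hol δ) = 2 * B₁ 0 0 * Real.cosh ((τ * L + L) / 2) := by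
    rw [e2, tr_conj, tr_mul_comm, mul_assoc, translation_mul_translation, tr_mul_translation,
      ← heq, Real.cosh_eq]
    ring
  rw [← hXγ] at hP
  -- The lift of δ may have negative trace; its negative is then used for B.
  rcases hsign with hs | hs <;> rw [hs] at t1 t2
  · exact ⟨A, X.hol δ, hP, Or.inl rfl, htrA, t1, t2⟩
  · refine ⟨A, -X.hol δ, hP, Or.inr (neg_neg _).symm, htrA, ?_, ?_⟩
    · rw [tr_neg, t1]; ring
    · rw [mul_neg, tr_neg, t2]; ring

/-! ### Powers of a matrix of determinant one. -/

/-- The Chebyshev polynomials of the second kind, in the normalization of traces. -/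
def cheb (x : ℝ) : ℕ → ℝ
  | 0 => 0
  | 1 => 1
  | n + 2 => x * cheb x (n + 1) - cheb x n

lemma cheb_add_two (x : ℝ) (n : ℕ) : cheb x (n + 2) = x * cheb x (n + 1) - cheb x n := rfl

lemma cheb_nonneg_and_add_one_le {x : ℝ} (hx : 2 ≤ x) (n : ℕ) :
    0 ≤ cheb x n ∧ cheb x n + 1 ≤ cheb x (n + 1) := by
  induction n with
  | zero => simp [cheb]
  | succ n ih =>
    refine ⟨by linarith, ?_⟩
    rw [cheb_add_two]
    nlinarith

lemma cheb_sq (x : ℝ) (n : ℕ) :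
    cheb x (n + 1) ^ 2 - x * cheb x (n + 1) * cheb x n + cheb x n ^ 2 = 1 := by
  induction n with
  | zero => simp [cheb]
  | succ n ih =>
    rw [cheb_add_two]
    linear_combination ih

lemma pow_succ_eq_cheb {x : ℝ} {M : Matrix (Fin 2) (Fin 2) ℝ} (h : M * M = x • M - 1) (n : ℕ) :
    M ^ (n + 1) = cheb x (n + 1) • M - cheb x n • 1 := by
  induction n with
  | zero => simp [cheb]
  | succ n ih =>
    rw [pow_succ, ih, sub_mul, Matrix.smul_mul, h, cheb_add_two]
    ext i j
    simp
    ring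

/-- The growth of a Chebyshev combination close to the identity. -/
lemma half_le_cheb {x σ : ℝ} (hx : 2 ≤ x) (hx3 : x ≤ 3)
    (h : 12 * (1 - σ) ^ 2 ≤ x - 2) (n : ℕ) : 1 / 2 ≤ σ * cheb x (n + 1) - cheb x n := by
  obtain ⟨h0, h1⟩ := cheb_nonneg_and_add_one_le hx n
  have hsq := cheb_sq x n
  -- With U = `cheb x`, the target is (U(n+1) − U(n)) − (1 − σ)U(n+1). The first term is at least 1,
  -- so it suffices that the second is at most half of it. This follows from (U(n+1) − U(n))² = 1 +
  -- (x − 2)U(n+1)U(n) and, for n ≥ 1, U(n+1) ≤ 3U(n).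
  have key : 4 * (1 - σ) ^ 2 * cheb x (n + 1) ^ 2 ≤ (cheb x (n + 1) - cheb x n) ^ 2 := by
    rcases n with - | n
    · simp only [cheb]
      nlinarith
    · have h3 : cheb x (n + 2) ≤ 3 * cheb x (n + 1) := by
        have := (cheb_nonneg_and_add_one_le hx n).1
        rw [cheb_add_two]
        nlinarith
      have hp : 0 ≤ cheb x (n + 2) := by linarith
      have e : (cheb x (n + 2) - cheb x (n + 1)) ^ 2 =
          1 + (x - 2) * (cheb x (n + 2) * cheb x (n + 1)) := by linear_combination hsq
      have h4 : cheb x (n + 2) ^ 2 ≤ 3 * (cheb x (n + 2) * cheb x (n + 1)) := by nlinarith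
      have h5 : 12 * (1 - σ) ^ 2 * (cheb x (n + 2) * cheb x (n + 1)) ≤
          (x - 2) * (cheb x (n + 2) * cheb x (n + 1)) :=
        mul_le_mul_of_nonneg_right h (mul_nonneg hp h0)
      have h6 := mul_le_mul_of_nonneg_left h4 (by positivity : 0 ≤ 4 * (1 - σ) ^ 2)
      show 4 * (1 - σ) ^ 2 * cheb x (n + 2) ^ 2 ≤ (cheb x (n + 2) - cheb x (n + 1)) ^ 2
      rw [e]
      linarith
  have h2 : 2 * (1 - σ) * cheb x (n + 1) ≤ cheb x (n + 1) - cheb x n := by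
    apply le_of_sq_le_sq _ (by linarith)
    linarith [key, show (2 * (1 - σ) * cheb x (n + 1)) ^ 2 =
      4 * (1 - σ) ^ 2 * cheb x (n + 1) ^ 2 by ring]
  linarith

/-! ### Excursions from side 0 in the presence of a short geodesic. -/

/-- The parameters of a structure with a short geodesic of trace `x` that misses the side `0`. -/
structure IsShort (s : Fin 3 → ℝ) (x : ℝ) : Prop where
  pos : ∀ j, 0 < s j
  prod : s 0 * s 1 * s 2 = 1
  le_one : s 0 ≤ 1
  half_le : 1 / 2 ≤ s 0
  large : 16 ≤ s 1
  trace : x = s 1 * s 2 + s 0 + s 2 / s 1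
  le_trace : x ≤ 9 / 4
  gap : 12 * (1 - s 0) ^ 2 ≤ x - 2

/-- Matrices that occur as holonomy of closed paths based at the side `0`. -/
inductive IsGood : Matrix (Fin 2) (Fin 2) ℝ → Prop
  | lower (h : ℝ) (hh : h = 0 ∨ 2 ≤ h) : IsGood !![1, 0; h, 1]
  | upper (h : ℝ) (hh : h = 0 ∨ 1 ≤ h) : IsGood !![1, h; 0, 1]
  | big (M : Matrix (Fin 2) (Fin 2) ℝ) (h00 : 1 ≤ M 0 0) (h11 : 1 ≤ M 1 1) (h01 : 0 ≤ M 0 1)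
      (h10 : 0 ≤ M 1 0) (h : 9 / 4 ≤ M 0 0 + M 1 1) : IsGood M

lemma IsGood.entries {M : Matrix (Fin 2) (Fin 2) ℝ} (h : IsGood M) :
    1 ≤ M 0 0 ∧ 1 ≤ M 1 1 ∧ 0 ≤ M 0 1 ∧ 0 ≤ M 1 0 := by
  rcases h with ⟨h, rfl | hh⟩ | ⟨h, rfl | hh⟩ | _ <;> simp [*] <;> linarith

lemma isGood_one : IsGood 1 := by
  rw [Matrix.one_fin_two]
  exact IsGood.lower 0 (Or.inl rfl)

lemma IsGood.trace {M : Matrix (Fin 2) (Fin 2) ℝ} (h : IsGood M) :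
    M.trace = 2 ∨ 9 / 4 ≤ M.trace := by
  rw [Matrix.trace_fin_two]
  rcases h with ⟨h, hh⟩ | ⟨h, hh⟩ | ⟨_, _, _, _, _, h⟩
  · left; simp; norm_num
  · left; simp; norm_num
  · exact Or.inr h

/-- Diagonal entries at least 1 and nonnegative entries elsewhere keep a big trace big; two
nontrivial unipotents of opposite type have a product of trace 2 + hh' ≥ 4. -/
lemma IsGood.mul {M N : Matrix (Fin 2) (Fin 2) ℝ} (hM : IsGood M) (hN : IsGood N) :
    IsGood (M * N) := by
  have eM := hM.entries
  have eN := hN.entries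
  have hbig : (9 / 4 ≤ M 0 0 * N 0 0 + M 0 1 * N 1 0 + (M 1 0 * N 0 1 + M 1 1 * N 1 1)) →
      IsGood (M * N) := by
    intro h
    obtain ⟨a, b, c, d⟩ := eM
    obtain ⟨a', b', c', d'⟩ := eN
    apply IsGood.big <;> simp only [Matrix.mul_apply, Fin.sum_univ_two]
    · nlinarith [mul_nonneg c d']
    · nlinarith [mul_nonneg d c']
    · have := mul_nonneg c (by linarith : 0 ≤ N 1 1)
      have := mul_nonneg (by linarith : 0 ≤ M 0 0) c'
      linarith
    · have := mul_nonneg d (by linarith : 0 ≤ N 0 0)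
      have := mul_nonneg (by linarith : 0 ≤ M 1 1) d'
      linarith
    · exact h
  rcases hM with ⟨h, hh⟩ | ⟨h, hh⟩ | ⟨_, _, _, _, _, h⟩
  · rcases hN with ⟨h', hh'⟩ | ⟨h', hh'⟩ | ⟨_, _, _, _, _, h'⟩
    · have e : !![1, 0; h, 1] * !![1, 0; h', 1] = !![1, 0; h + h', (1 : ℝ)] := by simp
      rw [e]
      apply IsGood.lower
      rcases hh with rfl | hh
      · simpa using hh'
      · rcases hh' with rfl | hh'
        · simpa using Or.inr hh
        · right
          linarith
    · rcases hh with rfl | hh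
      · rw [← Matrix.one_fin_two, one_mul]
        exact .upper _ hh'
      · rcases hh' with rfl | hh'
        · rw [← Matrix.one_fin_two, mul_one]
          exact .lower _ (Or.inr hh)
        · apply hbig
          simp
          nlinarith
    · apply hbig
      obtain ⟨a, b, c, d⟩ := eM
      obtain ⟨a', b', c', d'⟩ := eN
      nlinarith [mul_nonneg c d', mul_nonneg d c']
  · rcases hN with ⟨h', hh'⟩ | ⟨h', hh'⟩ | ⟨_, _, _, _, _, h'⟩
    · rcases hh with rfl | hh
      · rw [← Matrix.one_fin_two, one_mul]
        exact .lower _ hh'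
      · rcases hh' with rfl | hh'
        · rw [← Matrix.one_fin_two, mul_one]
          exact .upper _ (Or.inr hh)
        · apply hbig
          simp
          nlinarith
    · have e : !![1, h; 0, 1] * !![1, h'; 0, 1] = !![1, h + h'; 0, (1 : ℝ)] := by
        simp [add_comm]
      rw [e]
      apply IsGood.upper
      rcases hh with rfl | hh
      · simpa using hh'
      · rcases hh' with rfl | hh'
        · simpa using Or.inr hh
        · right
          linarith
    · apply hbig
      obtain ⟨a, b, c, d⟩ := eM
      obtain ⟨a', b', c', d'⟩ := eN
      nlinarith [mul_nonneg c d', mul_nonneg d c']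
  · apply hbig
    obtain ⟨a, b, c, d⟩ := eM
    obtain ⟨a', b', c', d'⟩ := eN
    nlinarith [mul_nonneg c d', mul_nonneg d c']

/-- The positive matrix of the short geodesic, based at the side `1`. -/
noncomputable def core (s : Fin 3 → ℝ) : Matrix (Fin 2) (Fin 2) ℝ :=
  leftTurn (s 1) * rightTurn (s 2)

/-- The positive matrix of the short geodesic, based at the side `2`. -/
noncomputable def core' (s : Fin 3 → ℝ) : Matrix (Fin 2) (Fin 2) ℝ :=
  rightTurn (s 2) * leftTurn (s 1)

namespace IsShort

variable {s : Fin 3 → ℝ} {x : ℝ}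

lemma inv_zero (h : IsShort s x) : (s 0)⁻¹ = s 1 * s 2 :=
  inv_eq_of_mul_eq_one_left (by rw [← h.prod]; ring)

lemma inv_two (h : IsShort s x) : (s 2)⁻¹ = s 0 * s 1 :=
  inv_eq_of_mul_eq_one_left (by rw [← h.prod])

lemma one_le (h : IsShort s x) : 1 ≤ s 1 * s 2 := by
  rw [← h.inv_zero]
  exact (one_le_inv₀ (h.pos 0)).2 h.le_one

lemma two_le (h : IsShort s x) : 2 ≤ x := by
  have := h.gap
  nlinarith [sq_nonneg (1 - s 0)]

lemma core_eq (h : IsShort s x) :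
    core s = !![s 1 * s 2, s 1 * s 2; s 2 / s 1, s 2 / s 1 + s 0] := by
  have h1 := h.pos 1
  rw [core, leftTurn, rightTurn, h.inv_two]
  ext i j
  fin_cases i <;> fin_cases j <;> simp <;> field_simp

lemma core'_eq (h : IsShort s x) :
    core' s = !![s 1 * s 2 + s 2 / s 1, s 2 / s 1; s 0, s 0] := by
  have h1 := h.pos 1
  rw [core', leftTurn, rightTurn, h.inv_two]
  ext i j
  fin_cases i <;> fin_cases j <;> simp <;> field_simp

lemma core_mul_self (h : IsShort s x) : core s * core s = x • core s - 1 := by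
  have hp := h.prod
  rw [h.core_eq, h.trace]
  ext i j
  fin_cases i <;> fin_cases j <;> simp
  · linear_combination (-1) * hp
  · ring
  · ring
  · linear_combination (-1) * hp

lemma core'_mul_self (h : IsShort s x) : core' s * core' s = x • core' s - 1 := by
  have hp := h.prod
  rw [h.core'_eq, h.trace]
  ext i j
  fin_cases i <;> fin_cases j <;> simp
  · linear_combination (-1) * hp
  · ring
  · ring
  · linear_combination (-1) * hp

lemma nonneg_core_pow (h : IsShort s x) (r : ℕ) : Nonneg (core s ^ r) := by
  have h1 : Nonneg (core s) := by
    intro i j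
    have := h.pos 0
    have := h.pos 1
    have := h.pos 2
    rw [h.core_eq]
    fin_cases i <;> fin_cases j <;> simp <;> positivity
  induction r with
  | zero => exact nonneg_one
  | succ r ih => rw [pow_succ]; exact ih.mul h1

lemma nonneg_core'_pow (h : IsShort s x) (r : ℕ) : Nonneg (core' s ^ r) := by
  have h1 : Nonneg (core' s) := by
    intro i j
    have := h.pos 0
    have := h.pos 1
    have := h.pos 2
    rw [h.core'_eq]
    fin_cases i <;> fin_cases j <;> simp <;> positivity
  induction r with
  | zero => exact nonneg_one
  | succ r ih => rw [pow_succ]; exact ih.mul h1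

lemma one_le_core_pow (h : IsShort s x) (r : ℕ) : 1 ≤ (core s ^ (r + 1)) 0 0 ∧
    1 ≤ (core s ^ (r + 1)) 0 1 := by
  have h1 := h.one_le
  obtain ⟨h0, hr⟩ := cheb_nonneg_and_add_one_le h.two_le r
  rw [pow_succ_eq_cheb h.core_mul_self, h.core_eq]
  simp
  constructor <;> nlinarith

/-- The delicate entry is the last: it equals s₀U(r+1) − U(r) with s₀ ≤ 1, and `gap` keeps it from
decaying as r grows. -/
lemma core'_pow_entries (h : IsShort s x) (r : ℕ) : 1 ≤ (core' s ^ (r + 1)) 0 0 ∧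
    s 0 ≤ (core' s ^ (r + 1)) 1 0 ∧ 1 / 2 ≤ (core' s ^ (r + 1)) 1 1 := by
  have h1 := h.one_le
  have hs0 := h.pos 0
  have hs := div_pos (h.pos 2) (h.pos 1)
  obtain ⟨h0, hr⟩ := cheb_nonneg_and_add_one_le h.two_le r
  have hh := half_le_cheb h.two_le (by linarith [h.le_trace]) h.gap r
  rw [pow_succ_eq_cheb h.core'_mul_self, h.core'_eq]
  simp
  refine ⟨?_, ?_, ?_⟩
  · nlinarith
  · nlinarith
  · linarith

lemma le_trace_core_pow (h : IsShort s x) (r : ℕ) : x ≤ (core s ^ (r + 1)).trace := by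
  rw [pow_succ_eq_cheb h.core_mul_self, Matrix.trace_sub, Matrix.trace_smul, Matrix.trace_smul,
    Matrix.trace_one, h.core_eq, Matrix.trace_fin_two]
  have e : s 1 * s 2 + (s 2 / s 1 + s 0) = x := by rw [h.trace]; ring
  obtain ⟨h0, hr⟩ := cheb_nonneg_and_add_one_le h.two_le r
  have := h.two_le
  simp [e]
  nlinarith

/-- This lemma and its three analogues below cover all excursions from side 0 back to it: a
departure to the left or right, r windings along the short geodesic, and a return from the side
first reached or through the other one. Here the bound `16 ≤ s 1` dominates. -/
lemma isGood_left_right (h : IsShort s x) (r : ℕ) :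
    IsGood (leftTurn (s 0) * core s ^ r * rightTurn (s 1)) := by
  have hn := h.nonneg_core_pow r
  have hp : 1 ≤ (core s ^ r) 0 0 := by
    rcases r with - | r
    · simp
    · exact (h.one_le_core_pow r).1
  have a := h.half_le
  have b := h.large
  have c := h.one_le
  have h01 := hn 0 1
  have h10 := hn 1 0
  have h11 := hn 1 1
  generalize core s ^ r = M at *
  have hM : M = !![M 0 0, M 0 1; M 1 0, M 1 1] := Matrix.eta_fin_two M
  have k1 : 8 ≤ s 0 * M 0 0 * s 1 := by
    have : 1 / 2 ≤ s 0 * M 0 0 := by nlinarith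
    nlinarith
  have k2 : 16 ≤ s 1 * s 2 * (M 0 0 + M 1 0) * s 1 := by
    have : 1 ≤ s 1 * s 2 * (M 0 0 + M 1 0) := by nlinarith
    nlinarith
  have h1 := h.pos 1
  have h2 := h.pos 2
  have h0 := h.pos 0
  have k3 : 0 ≤ s 1 * s 2 * (M 0 1 + M 1 1) * (s 1)⁻¹ := by positivity
  have k4 : 0 ≤ s 0 * M 0 1 * (s 1)⁻¹ := by positivity
  rw [hM, leftTurn, rightTurn, h.inv_zero]
  apply IsGood.big <;> simp <;> nlinarith

lemma left_mul_left_eq (h : IsShort s x) :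
    leftTurn (s 1) * leftTurn (s 2) = !![s 1 * s 2, 0; s 2 / s 1 + s 0, s 0] := by
  have h1 := h.pos 1
  rw [leftTurn, leftTurn, h.inv_two]
  ext i j
  fin_cases i <;> fin_cases j <;> simp <;> field_simp

lemma right_mul_right_eq (h : IsShort s x) :
    rightTurn (s 2) * rightTurn (s 1) = !![s 1 * s 2, s 1 * s 2 + s 2 / s 1; 0, s 0] := by
  have h1 := h.pos 1
  rw [rightTurn, rightTurn, h.inv_two]
  ext i j
  fin_cases i <;> fin_cases j <;> simp <;> field_simp

lemma isGood_left_left (h : IsShort s x) (r : ℕ) :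
    IsGood (leftTurn (s 0) * core s ^ r * (leftTurn (s 1) * leftTurn (s 2))) := by
  have hp := h.prod
  have a := h.half_le
  have c := h.one_le
  have hs := div_pos (h.pos 2) (h.pos 1)
  have h0 := h.pos 0
  rw [h.left_mul_left_eq, leftTurn, h.inv_zero]
  rcases r with - | r
  -- Without winding, the path makes three left turns around an ideal vertex, so the matrix is
  -- unipotent.
  · have e : !![s 0, 0; s 1 * s 2, s 1 * s 2] * core s ^ 0 *
        !![s 1 * s 2, 0; s 2 / s 1 + s 0, s 0] =
        !![1, 0; s 1 * s 2 * (s 1 * s 2) + s 1 * s 2 * (s 2 / s 1) + 1, 1] := by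
      rw [pow_zero, mul_one]
      ext i j
      fin_cases i <;> fin_cases j <;> simp <;> linear_combination hp
    rw [e]
    exact .lower _ (Or.inr (by nlinarith))
  · have hn := h.nonneg_core_pow (r + 1)
    obtain ⟨p, q⟩ := h.one_le_core_pow r
    have h10 := hn 1 0
    have h11 := hn 1 1
    generalize core s ^ (r + 1) = M at *
    have hM : M = !![M 0 0, M 0 1; M 1 0, M 1 1] := Matrix.eta_fin_two M
    have k1 : 1 + s 0 ^ 2 ≤ s 0 * M 0 0 * (s 1 * s 2) + s 0 * M 0 1 * (s 2 / s 1 + s 0) := by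
      have e1 : s 0 * M 0 0 * (s 1 * s 2) = M 0 0 := by linear_combination M 0 0 * hp
      have e2 : s 0 * s 0 ≤ s 0 * M 0 1 * (s 2 / s 1 + s 0) := by
        apply mul_le_mul <;> nlinarith
      nlinarith
    have k2 : 1 ≤ (s 1 * s 2 * M 0 1 + s 1 * s 2 * M 1 1) * s 0 := by
      have e1 : (s 1 * s 2 * M 0 1 + s 1 * s 2 * M 1 1) * s 0 = M 0 1 + M 1 1 := by
        linear_combination (M 0 1 + M 1 1) * hp
      linarith
    have h1 := h.pos 1
    have h2 := h.pos 2
    rw [hM]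
    apply IsGood.big <;> simp
    · nlinarith
    · linarith
    · positivity
    · positivity
    · nlinarith

lemma isGood_right_left (h : IsShort s x) (r : ℕ) :
    IsGood (rightTurn (s 0) * core' s ^ r * leftTurn (s 2)) := by
  have hn := h.nonneg_core'_pow r
  have hp : 1 / 2 ≤ (core' s ^ r) 1 1 := by
    rcases r with - | r
    · simp; norm_num
    · exact (h.core'_pow_entries r).2.2
  have a := h.half_le
  have b := h.large
  have c := h.one_le
  have h00 := hn 0 0
  have h01 := hn 0 1
  have h10 := hn 1 0
  generalize core' s ^ r = M at *
  have hM : M = !![M 0 0, M 0 1; M 1 0, M 1 1] := Matrix.eta_fin_two M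
  have h1 := h.pos 1
  have h2 := h.pos 2
  have h0 := h.pos 0
  have k0 : 8 ≤ s 0 * s 1 := by nlinarith
  have k1 : 1 / 4 ≤ s 0 * M 0 1 + s 0 * M 1 1 := by nlinarith [mul_nonneg h0.le h01]
  have k1' : 2 ≤ (s 0 * M 0 1 + s 0 * M 1 1) * (s 0 * s 1) := by nlinarith
  have k2 : 1 / 2 ≤ s 1 * s 2 * M 1 1 := by nlinarith
  have k2' : 4 ≤ s 1 * s 2 * M 1 1 * (s 0 * s 1) := by nlinarith
  have k3 : 0 ≤ (s 0 * M 0 0 + s 0 * M 1 0) * s 2 := by positivity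
  have k4 : 0 ≤ s 1 * s 2 * M 1 0 * s 2 := by positivity
  rw [hM, leftTurn, rightTurn, h.inv_zero, h.inv_two]
  apply IsGood.big <;> simp <;> linarith

lemma isGood_right_right (h : IsShort s x) (r : ℕ) :
    IsGood (rightTurn (s 0) * core' s ^ r * (rightTurn (s 2) * rightTurn (s 1))) := by
  have hp := h.prod
  have a := h.half_le
  have c := h.one_le
  have hs := div_pos (h.pos 2) (h.pos 1)
  have h0 := h.pos 0
  rw [h.right_mul_right_eq, rightTurn, h.inv_zero]
  rcases r with - | r
  -- Three right turns around an ideal vertex: again unipotent.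
  · have e : !![s 0, s 0; 0, s 1 * s 2] * core' s ^ 0 *
        !![s 1 * s 2, s 1 * s 2 + s 2 / s 1; 0, s 0] =
        !![1, 1 + s 0 * (s 2 / s 1) + s 0 * s 0; 0, 1] := by
      rw [pow_zero, mul_one]
      ext i j
      fin_cases i <;> fin_cases j <;> simp <;> linear_combination hp
    rw [e]
    exact .upper _ (Or.inr (by nlinarith))
  · have hn := h.nonneg_core'_pow (r + 1)
    obtain ⟨p, t, v⟩ := h.core'_pow_entries r
    have h01 := hn 0 1
    generalize core' s ^ (r + 1) = M at *
    have hM : M = !![M 0 0, M 0 1; M 1 0, M 1 1] := Matrix.eta_fin_two M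
    have h1 := h.pos 1
    have h2 := h.pos 2
    have k1 : (s 0 * M 0 0 + s 0 * M 1 0) * (s 1 * s 2) = M 0 0 + M 1 0 := by
      linear_combination (M 0 0 + M 1 0) * hp
    have k2 : s 1 * s 2 * M 1 1 * s 0 = M 1 1 := by linear_combination M 1 1 * hp
    have k3 : 1 ≤ s 1 * s 2 * M 1 0 * (s 1 * s 2 + s 2 / s 1) := by
      have e1 : 1 ≤ s 1 * s 2 * M 1 0 := by
        calc 1 = s 1 * s 2 * s 0 := by rw [← hp]; ring
          _ ≤ s 1 * s 2 * M 1 0 := by gcongr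
      nlinarith
    have t0 : 0 ≤ M 1 0 := by linarith
    rw [hM]
    apply IsGood.big <;> simp
    · linarith
    · linarith
    · positivity
    · positivity
    · linarith

end IsShort

/-! ### Traces of all closed words in the half-turns. -/

/-- The products of turns along reduced paths that start at the side `0`, sorted by the position
since the last visit of that side. -/
inductive Reaches (s : Fin 3 → ℝ) : Fin 3 → Matrix (Fin 2) (Fin 2) ℝ → Prop
  | base {G} (hG : IsGood G) : Reaches s 0 G
  | left {G} (hG : IsGood G) (r : ℕ) : Reaches s 1 (G * (leftTurn (s 0) * core s ^ r))
  | leftLeft {G} (hG : IsGood G) (r : ℕ) :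
      Reaches s 2 (G * (leftTurn (s 0) * core s ^ r * leftTurn (s 1)))
  | right {G} (hG : IsGood G) (r : ℕ) : Reaches s 2 (G * (rightTurn (s 0) * core' s ^ r))
  | rightRight {G} (hG : IsGood G) (r : ℕ) :
      Reaches s 1 (G * (rightTurn (s 0) * core' s ^ r * rightTurn (s 2)))

lemma Reaches.step {s : Fin 3 → ℝ} {x : ℝ} (h : IsShort s x) {j k : Fin 3}
    {M : Matrix (Fin 2) (Fin 2) ℝ} (hM : Reaches s j M) (hjk : j ≠ k) :
    Reaches s k (M * turn s j k) := by
  rcases hM with ⟨hG⟩ | ⟨hG, r⟩ | ⟨hG, r⟩ | ⟨hG, r⟩ | ⟨hG, r⟩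
  · fin_cases k
    · exact absurd rfl hjk
    · simpa [turn] using Reaches.left (s := s) hG 0
    · simpa [turn] using Reaches.right (s := s) hG 0
  · fin_cases k
    · simpa [turn, mul_assoc] using Reaches.base (s := s) (hG.mul (h.isGood_left_right r))
    · exact absurd rfl hjk
    · simpa [turn, mul_assoc] using Reaches.leftLeft (s := s) hG r
  · fin_cases k
    · simpa [turn, mul_assoc] using Reaches.base (s := s) (hG.mul (h.isGood_left_left r))
    · simpa [turn, mul_assoc, pow_succ, core] using Reaches.left (s := s) hG (r + 1)
    · exact absurd rfl hjk
  · fin_cases k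
    · simpa [turn, mul_assoc] using Reaches.base (s := s) (hG.mul (h.isGood_right_left r))
    · simpa [turn, mul_assoc] using Reaches.rightRight (s := s) hG r
    · exact absurd rfl hjk
  · fin_cases k
    · simpa [turn, mul_assoc] using Reaches.base (s := s) (hG.mul (h.isGood_right_right r))
    · exact absurd rfl hjk
    · simpa [turn, mul_assoc, pow_succ, core'] using Reaches.right (s := s) hG (r + 1)

lemma Reaches.path {s : Fin 3 → ℝ} {x : ℝ} (h : IsShort s x) {j k : Fin 3} {l : List (Fin 3)}
    {M : Matrix (Fin 2) (Fin 2) ℝ} (hM : Reaches s j M)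
    (hl : List.IsChain (· ≠ ·) (j :: (l ++ [k]))) : Reaches s k (M * path s j (l ++ [k])) := by
  induction l generalizing j M with
  | nil =>
    simp at hl
    simpa [PuncturedTorus.path] using hM.step h hl
  | cons i l ih =>
    rw [List.cons_append, List.isChain_cons_cons] at hl
    rw [List.cons_append, PuncturedTorus.path, ← mul_assoc]
    exact ih (hM.step h hl.1) hl.2

lemma trace_path_zero {s : Fin 3 → ℝ} {x : ℝ} (h : IsShort s x) {l : List (Fin 3)}
    (hl : List.IsChain (· ≠ ·) (0 :: (l ++ [0]))) :
    (path s 0 (l ++ [0])).trace = 2 ∨ x ≤ (path s 0 (l ++ [0])).trace := by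
  have := (Reaches.base (s := s) isGood_one).path h hl
  rw [one_mul] at this
  generalize path s 0 (l ++ [0]) = M at *
  obtain ⟨hG⟩ := this
  exact hG.trace.imp_right h.le_trace.trans

/-- Such a path can only alternate between the sides 1 and 2. -/
lemma path_avoiding_zero (s : Fin 3 → ℝ) {l : List (Fin 3)} (h0 : 0 ∉ l) {j : Fin 3}
    (hl : List.IsChain (· ≠ ·) (j :: (l ++ [1]))) (hj : j ≠ 0) :
    ∃ r, (j = 1 → path s j (l ++ [1]) = core s ^ (r + 1)) ∧
      (j = 2 → path s j (l ++ [1]) = rightTurn (s 2) * core s ^ r) := by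
  induction l generalizing j with
  | nil =>
    simp at hl
    have : j = 2 := by omega
    subst this
    refine ⟨0, by simp, fun _ => ?_⟩
    simp [path, turn]
  | cons i l ih =>
    rw [List.cons_append, List.isChain_cons_cons] at hl
    simp only [List.mem_cons, not_or] at h0
    obtain ⟨r, h1, h2⟩ := ih h0.2 hl.2 (Ne.symm h0.1)
    have hij : (i = 1 ∧ j = 2) ∨ (i = 2 ∧ j = 1) := by
      have := h0.1
      have := hl.1
      omega
    rcases hij with ⟨rfl, rfl⟩ | ⟨rfl, rfl⟩
    · refine ⟨r + 1, by simp, fun _ => ?_⟩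
      rw [List.cons_append, path, h1 rfl]
      simp [turn]
    · refine ⟨r, fun _ => ?_, by simp⟩
      rw [List.cons_append, path, h2 rfl, pow_succ', ← mul_assoc]
      simp [turn, core]

/-- Repeating the first side at the end closes the path; the additional half-turn cancels against
the flip left over by `word_eq_path`. -/
lemma abs_trace_word_cons (s : Fin 3 → ℝ) (hs : ∀ j, 0 < s j) {j : Fin 3} {l : List (Fin 3)}
    (hl : List.IsChain (· ≠ ·) (j :: (l ++ [j]))) :
    |(word s (j :: l)).trace| = |(path s j (l ++ [j])).trace| := by
  obtain ⟨k, hk, h⟩ := word_eq_path s j (l ++ [j]) hl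
  have hkj : k = j := by simpa using hk
  subst hkj
  have e1 : (word s (k :: l)).trace = (rotInv k * word s (k :: l) * rot k).trace := by
    rw [mul_assoc, Matrix.trace_mul_comm, mul_assoc, rot_mul_rotInv, mul_one]
  have e2 : rotInv k * word s (k :: (l ++ [k])) * (rot k * flip (s k)) =
      -(rotInv k * word s (k :: l) * rot k) := by
    calc rotInv k * word s (k :: (l ++ [k])) * (rot k * flip (s k))
        = rotInv k * word s (k :: l) * rot k * (flip (s k) * (rotInv k * rot k) * flip (s k)) := by
          rw [← List.cons_append, word_append, word_cons s k [], word_nil, mul_one, halfTurn]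
          simp only [mul_assoc]
      _ = _ := by rw [rotInv_mul_rot, mul_one, flip_mul_flip (hs k).ne', mul_neg, mul_one]
  have e3 : path s k (l ++ [k]) * (flip (s k) * rotInv k) * (rot k * flip (s k)) =
      -path s k (l ++ [k]) := by
    calc _ = path s k (l ++ [k]) * (flip (s k) * (rotInv k * rot k) * flip (s k)) := by
          simp only [mul_assoc]
      _ = _ := by rw [rotInv_mul_rot, mul_one, flip_mul_flip (hs k).ne', mul_neg, mul_one]
  rw [e1, ← abs_neg, ← Matrix.trace_neg, ← e2, ← abs_neg (path s k (l ++ [k])).trace,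
    ← Matrix.trace_neg, ← e3]
  rcases h with h | h <;> rw [h]
  rw [neg_mul, Matrix.trace_neg, abs_neg]

lemma isChain_ne_or_exists_cancel (l : List (Fin 3)) :
    List.IsChain (· ≠ ·) l ∨ ∃ u i v, l = u ++ i :: i :: v := by
  induction l with
  | nil => simp
  | cons j l ih =>
    rcases ih with ih | ⟨u, i, v, rfl⟩
    · rcases l with - | ⟨k, l⟩
      · simp
      · by_cases hjk : j = k
        · subst hjk
          exact Or.inr ⟨[], j, l, rfl⟩
        · exact Or.inl (List.isChain_cons_cons.2 ⟨hjk, ih⟩)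
    · exact Or.inr ⟨j :: u, i, v, rfl⟩

lemma trace_word_append_comm (s : Fin 3 → ℝ) (l m : List (Fin 3)) :
    (word s (l ++ m)).trace = (word s (m ++ l)).trace := by
  rw [word_append, word_append, Matrix.trace_mul_comm]

lemma trace_halfTurn (s : Fin 3 → ℝ) (j : Fin 3) : (halfTurn s j).trace = 0 := by
  rw [halfTurn, mul_assoc, Matrix.trace_mul_comm, mul_assoc, rotInv_mul_rot, mul_one]
  simp [flip, Matrix.trace_fin_two]

/-- A closed word is either cyclically reduced or can be shortened, unless it is a half-turn. -/
lemma isChain_or_shorter {s : Fin 3 → ℝ} (hs : ∀ j, 0 < s j) (j : Fin 3) (l : List (Fin 3)) :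
    List.IsChain (· ≠ ·) (j :: (l ++ [j])) ∨ (word s (j :: l)).trace = 0 ∨
      ∃ m, m.length < (j :: l).length ∧ (word s (j :: l)).trace = -(word s m).trace := by
  rcases isChain_ne_or_exists_cancel (j :: (l ++ [j])) with h | ⟨u, i, v, h⟩
  · exact Or.inl h
  · right
    -- If `v` is empty, the repeated pair lies at the seam of the cyclic word; otherwise it lies
    -- inside `j :: l`.
    rcases List.eq_nil_or_concat v with rfl | ⟨v, k, rfl⟩
    · have h' : (j :: l) ++ [j] = (u ++ [i]) ++ [i] := by simpa using h
      obtain ⟨h1, h2⟩ := List.append_inj' h' rfl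
      rcases u with - | ⟨k, u⟩
      · left
        rw [h1]
        simp [trace_halfTurn]
      · right
        have hk : j = k ∧ l = u ++ [i] := by simpa using h1
        have hij : j = i := by simpa using h2
        obtain ⟨rfl, rfl⟩ := hk
        subst hij
        refine ⟨u, by simp, ?_⟩
        have := word_cancel hs [] u j
        rw [← List.cons_append, trace_word_append_comm]
        simp only [List.nil_append] at this
        rw [List.singleton_append, this, Matrix.trace_neg]
    · right
      have h' : (j :: l) ++ [j] = (u ++ i :: i :: v) ++ [k] := by simpa using h
      obtain ⟨h1, -⟩ := List.append_inj' h' rfl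
      refine ⟨u ++ v, by rw [h1]; simp, ?_⟩
      rw [h1, word_cancel hs, Matrix.trace_neg]

/-- The trace allows cyclic rotation, so the word may start with side 0 if it occurs, otherwise with
side 1. It is then cyclically reduced, or has trace zero, or gets shorter; a word in side 2 alone
shortens to a trivial one or a half-turn. -/
theorem abs_trace_word {s : Fin 3 → ℝ} {x : ℝ} (h : IsShort s x) (l : List (Fin 3)) :
    |(word s l).trace| ≤ 2 ∨ x ≤ |(word s l).trace| := by
  induction hn : l.length using Nat.strong_induction_on generalizing l with
  | _ n ih =>
    subst hn
    by_cases h0 : 0 ∈ l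
    · obtain ⟨u, v, rfl⟩ := List.append_of_mem h0
      rw [trace_word_append_comm, List.cons_append]
      rcases isChain_or_shorter h.pos 0 (v ++ u) with hc | hc | ⟨m, hm, e⟩
      · rw [abs_trace_word_cons s h.pos hc]
        rcases trace_path_zero h hc with e | e
        · left
          rw [e]
          norm_num
        · right
          exact e.trans (le_abs_self _)
      · left
        rw [hc]
        norm_num
      · rw [e, abs_neg]
        exact ih _ (by simp at hm ⊢; omega) m rfl
    · by_cases h1 : 1 ∈ l
      · obtain ⟨u, v, rfl⟩ := List.append_of_mem h1
        rw [trace_word_append_comm, List.cons_append]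
        rcases isChain_or_shorter h.pos 1 (v ++ u) with hc | hc | ⟨m, hm, e⟩
        · rw [abs_trace_word_cons s h.pos hc]
          obtain ⟨r, hr, -⟩ := path_avoiding_zero s (l := v ++ u)
            (by simp at h0 ⊢; tauto) hc (by decide)
          right
          rw [hr rfl]
          exact (h.le_trace_core_pow r).trans (le_abs_self _)
        · left
          rw [hc]
          norm_num
        · rw [e, abs_neg]
          exact ih _ (by simp at hm ⊢; omega) m rfl
      · have h2 : ∀ j ∈ l, j = 2 := by
          intro j hj
          have : j ≠ 0 := fun e => h0 (e ▸ hj)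
          have : j ≠ 1 := fun e => h1 (e ▸ hj)
          omega
        rcases l with - | ⟨i, - | ⟨j, l⟩⟩
        · left
          simp
        · left
          simp [trace_halfTurn]
        · have hi := h2 i (by simp)
          have hj := h2 j (by simp)
          subst hi hj
          have := word_cancel h.pos [] l 2
          simp only [List.nil_append] at this
          rw [this, Matrix.trace_neg, abs_neg]
          exact ih _ (by simp) l rfl

/-! ### Growth exponents and Euclid's algorithm. -/

/-- `t` is `E ^ n` up to a relative error of at most `K / E ^ 2`. -/
def Near (E K : ℝ) (n : ℕ) (t : ℝ) : Prop := ∃ e, |e| ≤ K / E ^ 2 ∧ t = E ^ n * (1 + e)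

lemma Near.mono {E K K' : ℝ} {n : ℕ} {t : ℝ} (h : Near E K n t) (hK : K ≤ K') :
    Near E K' n t := by
  obtain ⟨e, he, rfl⟩ := h
  exact ⟨e, he.trans (by gcongr), rfl⟩

/-- With κ = K/E² ≤ 1/2 and η = E⁻², the ratio t₄/E^m is ((1 + e₁)² + θ(1 + e₂)²)/(1 + e₃) with θ =
E^(−2m) ≤ η. Numerator minus denominator is at most 7κ/2 + 9η/4, and the denominator is at least
1/2; this gives 7K + 5. -/
lemma Near.div_step {E K : ℝ} (hE : 1 ≤ E) (hKE : 2 * K ≤ E ^ 2) {m n : ℕ} (hm : 0 < m)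
    {t₁ t₂ t₃ t₄ : ℝ} (h₁ : Near E K (m + n) t₁) (h₂ : Near E K n t₂)
    (h₃ : Near E K (m + n + n) t₃) (h : t₄ * t₃ = t₁ ^ 2 + t₂ ^ 2) :
    Near E (7 * K + 5) m t₄ := by
  obtain ⟨e₁, he₁, rfl⟩ := h₁
  obtain ⟨e₂, he₂, rfl⟩ := h₂
  obtain ⟨e₃, he₃, rfl⟩ := h₃
  have hE0 : 0 < E := by linarith
  have hκ : K / E ^ 2 ≤ 1 / 2 := by
    rw [div_le_div_iff₀ (by positivity) (by norm_num)]
    linarith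
  set κ := K / E ^ 2 with hκdef
  set η := (E ^ 2)⁻¹ with hη
  have hη0 : 0 < η := by positivity
  obtain ⟨a₁, b₁⟩ := abs_le.1 he₁
  obtain ⟨a₂, b₂⟩ := abs_le.1 he₂
  obtain ⟨a₃, b₃⟩ := abs_le.1 he₃
  have hEm : E ^ 2 ≤ E ^ (2 * m) := pow_le_pow_right₀ hE (by omega)
  set θ := (E ^ (2 * m))⁻¹ with hθ
  have hθη : θ ≤ η := inv_anti₀ (by positivity) hEm
  have hθ0 : 0 < θ := by positivity
  have hp := pow_pos hE0 m
  have hq := pow_pos hE0 n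
  refine ⟨t₄ / E ^ m - 1, ?_, by field_simp; ring⟩
  have key : t₄ / E ^ m * (1 + e₃) = (1 + e₁) ^ 2 + θ * (1 + e₂) ^ 2 := by
    have e : θ = (E ^ m * E ^ m)⁻¹ := by rw [hθ, two_mul, pow_add]
    rw [e]
    simp only [pow_add] at h
    field_simp
    have h' : (E ^ n) ^ 2 * (t₄ * E ^ m * (1 + e₃)) =
        (E ^ n) ^ 2 * (E ^ m * E ^ m * (1 + e₁) ^ 2 + (1 + e₂) ^ 2) := by
      linear_combination h
    have := mul_left_cancel₀ (by positivity) h'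
    linarith
  set w := t₄ / E ^ m with hw
  have b1 : (1 + e₁) ^ 2 ≤ 1 + 5 / 2 * κ := by nlinarith
  have b1' : 1 - 2 * κ ≤ (1 + e₁) ^ 2 := by nlinarith
  have b2 : θ * (1 + e₂) ^ 2 ≤ η * (9 / 4) := by
    apply mul_le_mul hθη _ (by positivity) hη0.le
    nlinarith
  have b2' : 0 ≤ θ * (1 + e₂) ^ 2 := by positivity
  have hbound : (7 * K + 5) / E ^ 2 = 7 * κ + 5 * η := by rw [hκdef, hη]; field_simp
  rw [hbound, abs_le]
  have hκ0 : 0 ≤ κ := by linarith [abs_nonneg e₁]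
  constructor
  · by_contra! hlt
    nlinarith
  · by_contra! hlt
    nlinarith

lemma closure_mul_inv_pair (A B : SL(2, ℝ)) :
    Subgroup.closure {A * B⁻¹, B} = Subgroup.closure {A, B} := by
  have h : ∀ P Q : SL(2, ℝ), P ∈ Subgroup.closure {P, Q} ∧ Q ∈ Subgroup.closure {P, Q} :=
    fun P Q => ⟨Subgroup.subset_closure (by simp), Subgroup.subset_closure (by simp)⟩
  apply le_antisymm <;> rw [Subgroup.closure_le]
  · rintro M (rfl | rfl)
    · exact mul_mem (h A B).1 (inv_mem (h A B).2)
    · exact (h A M).2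
  · rintro M (rfl | rfl)
    · have := mul_mem (h (M * B⁻¹) B).1 (h (M * B⁻¹) B).2
      rwa [inv_mul_cancel_right] at this
    · exact (h (A * M⁻¹) M).2

lemma markoff_of_tr_commutator {A B : SL(2, ℝ)} (h : tr ⁅A, B⁆ = -2) :
    tr A ^ 2 + tr B ^ 2 + tr (A * B) ^ 2 = tr A * tr B * tr (A * B) := by
  rw [tr_commutator] at h
  linarith

lemma tr_commutator_mul_inv {A B : SL(2, ℝ)} (h : tr ⁅A, B⁆ = -2) :
    tr ⁅A * B⁻¹, B⁆ = -2 := by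
  have := markoff_of_tr_commutator h
  rw [tr_commutator, inv_mul_cancel_right, tr_mul_inv]
  linear_combination this

lemma tr_mul_inv_mul {A B : SL(2, ℝ)} (h : tr ⁅A, B⁆ = -2) :
    tr (A * B⁻¹) * tr (A * B) = tr A ^ 2 + tr B ^ 2 := by
  have := markoff_of_tr_commutator h
  rw [tr_mul_inv]
  linear_combination -this

lemma tr_commutator_swap (A B : SL(2, ℝ)) : tr ⁅B, A⁆ = tr ⁅A, B⁆ := by
  rw [← commutatorElement_inv, tr_inv]

/-- The Euclidean algorithm on the exponents of growth of two generators. -/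
theorem exists_reduced_pair (N : ℕ) : ∀ n₁ n₂ : ℕ, n₁ + n₂ = N → 0 < n₁ → 0 < n₂ →
    Nat.Coprime n₁ n₂ → ∀ K : ℝ, ∃ K' E₀ : ℝ, ∀ E, E₀ ≤ E → ∀ A B : SL(2, ℝ), tr ⁅A, B⁆ = -2 →
      Near E K n₁ (tr A) → Near E K n₂ (tr B) → Near E K (n₁ + n₂) (tr (A * B)) →
      ∃ A' B' : SL(2, ℝ), Subgroup.closure {A', B'} = Subgroup.closure {A, B} ∧
        tr ⁅A', B'⁆ = -2 ∧ Near E K' 1 (tr A') ∧ Near E K' 1 (tr B') ∧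
          Near E K' 2 (tr (A' * B')) := by
  induction N using Nat.strong_induction_on with
  | _ N ih =>
    have step : ∀ m n : ℕ, m + n + n = N → 0 < m → 0 < n → Nat.Coprime (m + n) n → ∀ K : ℝ,
        ∃ K' E₀ : ℝ, ∀ E, E₀ ≤ E → ∀ A B : SL(2, ℝ), tr ⁅A, B⁆ = -2 →
        Near E K (m + n) (tr A) → Near E K n (tr B) → Near E K (m + n + n) (tr (A * B)) →
        ∃ A' B' : SL(2, ℝ), Subgroup.closure {A', B'} = Subgroup.closure {A, B} ∧
          tr ⁅A', B'⁆ = -2 ∧ Near E K' 1 (tr A') ∧ Near E K' 1 (tr B') ∧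
            Near E K' 2 (tr (A' * B')) := by
      intro m n hN hm hn hco K
      obtain ⟨K', E₀, hE₀⟩ := ih (m + n) (by omega) m n rfl hm hn
        ((Nat.coprime_add_self_left (m := m) (n := n)).1 hco) (7 * |K| + 5)
      refine ⟨K', max E₀ (max 1 (2 * |K|)), fun E hE A B hAB h₁ h₂ h₃ => ?_⟩
      have hE1 : E₀ ≤ E := (le_max_left _ _).trans hE
      have hE2 : 1 ≤ E := (le_max_left _ _).trans ((le_max_right _ _).trans hE)
      have hE3 : 2 * |K| ≤ E := (le_max_right _ _).trans ((le_max_right _ _).trans hE)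
      have hKK : |K| ≤ 7 * |K| + 5 := by linarith [abs_nonneg K]
      have h₁ := h₁.mono (le_abs_self K)
      have h₂ := h₂.mono (le_abs_self K)
      have h₃ := h₃.mono (le_abs_self K)
      have h₄ := Near.div_step hE2 (by nlinarith) hm h₁ h₂ h₃ (tr_mul_inv_mul hAB)
      obtain ⟨A', B', hcl, h⟩ := hE₀ E hE1 (A * B⁻¹) B (tr_commutator_mul_inv hAB) h₄ (h₂.mono hKK)
        (by rw [inv_mul_cancel_right]; exact h₁.mono hKK)
      exact ⟨A', B', hcl.trans (closure_mul_inv_pair A B), h⟩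
    intro n₁ n₂ hN h₁ h₂ hco K
    rcases lt_trichotomy n₁ n₂ with hlt | heq | hlt
    · obtain ⟨m, rfl⟩ := Nat.exists_eq_add_of_lt hlt
      obtain ⟨K', E₀, hE₀⟩ := step (m + 1) n₁ (by omega) (by omega) h₁
        (by rw [Nat.coprime_comm]; convert hco using 1; omega) K
      refine ⟨K', E₀, fun E hE A B hAB hA hB hC => ?_⟩
      have e : m + 1 + n₁ = n₁ + m + 1 := by omega
      obtain ⟨A', B', hcl, h⟩ := hE₀ E hE B A (by rw [tr_commutator_swap, hAB])
        (by rwa [e]) hA (by rw [tr_mul_comm, e, add_comm _ n₁]; exact hC)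
      exact ⟨A', B', hcl.trans (by rw [Set.pair_comm]), h⟩
    -- Equal coprime exponents are both 1. The descent stops here: a further step would give
    -- exponent 0, the bounded trace of the short element.
    · subst heq
      have : n₁ = 1 := by simpa using hco
      subst this
      exact ⟨K, 0, fun E _ A B hAB hA hB hC => ⟨A, B, rfl, hAB, hA, hB, hC⟩⟩
    · obtain ⟨m, rfl⟩ := Nat.exists_eq_add_of_lt hlt
      have e : n₂ + m + 1 = m + 1 + n₂ := by omega
      rw [e] at hN hco ⊢
      exact step (m + 1) n₂ hN (by omega) h₂ hco K

/-! ### The short generator has the least hyperbolic trace. -/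

lemma range_pairHom (A B : SL(2, ℝ)) : (pairHom A B).range = Subgroup.closure {A, B} := by
  rw [pairHom, FreeGroup.range_lift_eq_closure]
  simp [Set.pair_comm]

lemma pairHom_eq_or_eq_neg {A B A' B' : SL(2, ℝ)} (hA : A' = A ∨ A' = -A)
    (hB : B' = B ∨ B' = -B) (w : FreeGroup (Fin 2)) :
    pairHom A' B' w = pairHom A B w ∨ pairHom A' B' w = -pairHom A B w := by
  induction w using FreeGroup.induction_on with
  | C1 => simp
  | of i => fin_cases i <;> simpa [pairHom]
  | inv_of i h =>
    rw [map_inv, map_inv]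
    rcases h with h | h
    · left; rw [h]
    · right
      rw [h]
      ext a b
      simp [Matrix.SpecialLinearGroup.coe_inv, Matrix.adjugate_fin_two]
  | mul v w hv hw =>
    rw [map_mul, map_mul]
    rcases hv with hv | hv <;> rcases hw with hw | hw <;> rw [hv, hw] <;> simp

lemma Teich.hol_eq_pairHom (X : Teich) (b : FreeGroupBasis (Fin 2) Pi1) (g : Pi1) :
    X.hol g = pairHom (X.hol (b 0)) (X.hol (b 1)) (b.repr g) := by
  have : X.hol = (pairHom (X.hol (b 0)) (X.hol (b 1))).comp b.repr.toMonoidHom := by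
    apply b.ext_hom
    intro i
    fin_cases i <;> simp [pairHom]
  exact DFunLike.congr_fun this g

/-- The systole is the length of the shortest trace. -/
lemma Teich.sys_eq (X : Teich) {x : ℝ} (hx : 2 < x) (h : ∃ g, |tr (X.hol g)| = x)
    (h' : ∀ g, |tr (X.hol g)| ≤ 2 ∨ x ≤ |tr (X.hol g)|) : X.sys = lengthOfTrace x := by
  have hsq : ∀ g, 4 < tr (X.hol g) ^ 2 ↔ 2 < |tr (X.hol g)| := by
    intro g
    rw [← sq_abs]
    constructor
    · intro h
      nlinarith [abs_nonneg (tr (X.hol g))]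
    · intro h
      nlinarith
  apply le_antisymm
  · obtain ⟨g, hg⟩ := h
    have h4 := (hsq g).2 (by rw [hg]; exact hx)
    refine csInf_le ⟨0, ?_⟩ ⟨g, ?_, ?_⟩
    · rintro _ ⟨g, -, rfl⟩
      exact Real.iInf_nonneg fun z => dist_nonneg
    · rw [isHyperbolic_iff, trace_eq_tr]
      exact h4
    · rw [X.len_eq h4]
      apply le_antisymm <;> apply lengthOfTrace_mono <;> rw [← hg, sq_abs]
  · obtain ⟨g, hg⟩ := h
    refine le_csInf ⟨_, g, ?_, rfl⟩ ?_
    · rw [isHyperbolic_iff, trace_eq_tr, hsq, hg]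
      exact hx
    · rintro _ ⟨g, hg, rfl⟩
      rw [isHyperbolic_iff, trace_eq_tr] at hg
      rw [X.len_eq hg]
      apply lengthOfTrace_mono
      rcases h' g with h | h
      · exact absurd ((hsq g).1 hg) (not_lt.2 h)
      · rw [← sq_abs (tr (X.hol g))]
        nlinarith

/-- The bound 36 = 16 · 9/4 gives `large`. For `gap`, Markoff's equation yields x − 2 = (x² + (z −
y)²)/(yz), and 12(z − y)² ≤ 4 ≤ x². -/
lemma isShort_sides {x y z : ℝ} (hx : 2 < x) (hx' : x ≤ 9 / 4) (hy : 0 < y) (hyz : y ≤ z)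
    (hzy : z ≤ 2 * y) (hz : 36 ≤ z) (hd : 3 * (z - y) ^ 2 ≤ 1)
    (h : x ^ 2 + y ^ 2 + z ^ 2 = x * y * z) : IsShort (sides x y z) x := by
  have hx0 : 0 < x := by linarith
  have hz0 : 0 < z := by linarith
  refine ⟨sides_pos hx0 hy hz0, ?_, ?_, ?_, ?_, ?_, hx', ?_⟩
  · simp [sides]
    field_simp
  · simp only [sides, Matrix.cons_val_zero]
    exact (div_le_one hz0).2 hyz
  · simp only [sides, Matrix.cons_val_zero]
    rw [div_le_div_iff₀ (by norm_num) hz0]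
    linarith
  · simp only [sides, Matrix.cons_val_one, Matrix.cons_val_zero]
    rw [le_div_iff₀ hx0]
    linarith
  · simp [sides]
    field_simp
    linarith
  · simp only [sides, Matrix.cons_val_zero]
    have e1 : x - 2 = (x ^ 2 + (z - y) ^ 2) / (y * z) := by
      rw [eq_div_iff (by positivity)]
      linear_combination -h
    have e2 : 12 * (1 - y / z) ^ 2 = 12 * (z - y) ^ 2 * (y / z) / (y * z) := by
      field_simp
    rw [e1, e2]
    apply div_le_div_of_nonneg_right _ (by positivity)
    have : y / z ≤ 1 := (div_le_one hz0).2 hyz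
    have : 12 * (z - y) ^ 2 * (y / z) ≤ 12 * (z - y) ^ 2 :=
      mul_le_of_le_one_right (by positivity) this
    nlinarith [sq_nonneg (z - y)]

/-- An element of the group has the trace of the same word in the model generators, which is a word
in half-turns up to sign. -/
lemma abs_tr_of_mem_closure {A B : SL(2, ℝ)} (hA : 0 < tr A) (hB : 0 < tr B)
    (hAB : 0 < tr (A * B)) (hc : tr ⁅A, B⁆ = -2)
    (h : IsShort (sides (tr A) (tr B) (tr (A * B))) (tr A)) {M : SL(2, ℝ)}
    (hM : M ∈ Subgroup.closure {A, B}) : |tr M| ≤ 2 ∨ tr A ≤ |tr M| := by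
  rw [← range_pairHom] at hM
  obtain ⟨w, rfl⟩ := hM
  obtain ⟨e1, e2, e3⟩ := tr_model hA hB hAB (markoff_of_tr_commutator hc)
  rw [tr_pairHom_eq e1.symm e2.symm e3.symm w]
  obtain ⟨l, -, -, hl⟩ := exists_list_pairHom (sides_pos hA hB hAB) w
  have : |tr (pairHom (modelLeft _ (sides_pos hA hB hAB)) (modelRight _ (sides_pos hA hB hAB)) w)| =
      |(word (sides (tr A) (tr B) (tr (A * B))) l).trace| := by
    rw [← trace_eq_tr]
    rcases hl with hl | hl <;> rw [hl]
    rw [Matrix.trace_neg, abs_neg]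
  rw [this]
  exact abs_trace_word h l

lemma closure_inv_mul_pair (A B : SL(2, ℝ)) :
    Subgroup.closure {A⁻¹, A * B} = Subgroup.closure {A, B} := by
  have h : ∀ P Q : SL(2, ℝ), P ∈ Subgroup.closure {P, Q} ∧ Q ∈ Subgroup.closure {P, Q} :=
    fun P Q => ⟨Subgroup.subset_closure (by simp), Subgroup.subset_closure (by simp)⟩
  apply le_antisymm <;> rw [Subgroup.closure_le]
  · rintro M (rfl | rfl)
    · exact inv_mem (h A B).1
    · exact mul_mem (h A B).1 (h A B).2
  · rintro M (rfl | rfl)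
    · have := inv_mem (h M⁻¹ (M * B)).1
      rwa [inv_inv] at this
    · have := mul_mem (h A⁻¹ (A * M)).1 (h A⁻¹ (A * M)).2
      rwa [inv_mul_cancel_left] at this

/-- In a group with a short generator, that generator has the least trace. -/
theorem abs_tr_of_short {A B : SL(2, ℝ)} (hc : tr ⁅A, B⁆ = -2) (hx : 2 < tr A)
    (hx' : tr A ≤ 9 / 4) (hB : 36 ≤ tr B) (hAB : 36 ≤ tr (A * B))
    (hd : 3 * (tr (A * B) - tr B) ^ 2 ≤ 1) {M : SL(2, ℝ)} (hM : M ∈ Subgroup.closure {A, B}) :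
    |tr M| ≤ 2 ∨ tr A ≤ |tr M| := by
  have hm := markoff_of_tr_commutator hc
  have hd1 : |tr (A * B) - tr B| ≤ 1 := by
    rw [← sq_le_one_iff_abs_le_one]
    linarith
  obtain ⟨d1, d2⟩ := abs_le.1 hd1
  rcases le_total (tr B) (tr (A * B)) with hle | hle
  · exact abs_tr_of_mem_closure (by linarith) (by linarith) (by linarith) hc
      (isShort_sides hx hx' (by linarith) hle (by linarith) hAB hd hm) hM
  -- The generators A⁻¹, AB interchange the two large traces, which restores the order required by
  -- `isShort_sides`.
  · rw [← closure_inv_mul_pair] at hM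
    have e1 : tr A⁻¹ = tr A := tr_inv A
    have e2 : tr (A⁻¹ * (A * B)) = tr B := by rw [inv_mul_cancel_left]
    have hc' : tr ⁅A⁻¹, A * B⁆ = -2 := by
      rw [tr_commutator, e1, e2]
      linarith
    have := abs_tr_of_mem_closure (by linarith) (by linarith) (by linarith) hc'
      (by
        rw [e1, e2]
        exact isShort_sides hx hx' (by linarith) hle (by linarith) hB
          (by nlinarith) (by linarith)) hM
    rwa [e1] at this

/-! ### Asymptotics of the short length. -/

/-- The right side, unlike the left, makes sense at x = 2: `dslope` extends arsinh(v)/v continuously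
to v = 0, and E²(x² − 4) has been rewritten without E. -/
lemma mul_lengthOfTrace_eq {E x d e₁ e₂ : ℝ} (hE : 0 < E) (hx : 2 < x) (h₁ : 0 < 1 + e₁)
    (h₂ : 0 < 1 + e₂) (h : (x - 2) * (E ^ 2 * ((1 + e₁) * (1 + e₂))) = x ^ 2 + d ^ 2) :
    E * lengthOfTrace x = √((x + 2) * (x ^ 2 + d ^ 2) / ((1 + e₁) * (1 + e₂))) *
      dslope Real.arsinh 0 (√(x ^ 2 - 4) / 2) := by
  have hpos : 0 < x ^ 2 - 4 := by nlinarith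
  have hv : 0 < √(x ^ 2 - 4) := Real.sqrt_pos.2 hpos
  have e : (x + 2) * (x ^ 2 + d ^ 2) / ((1 + e₁) * (1 + e₂)) = E ^ 2 * (x ^ 2 - 4) := by
    rw [← h]
    field_simp
    ring
  rw [e, Real.sqrt_mul (by positivity), Real.sqrt_sq hE.le, dslope_of_ne _ (by positivity),
    slope_def_field, lengthOfTrace, Real.arsinh_zero]
  generalize √(x ^ 2 - 4) = v at *
  rw [sub_zero, sub_zero]
  field_simp

/-- The asymptotics of the length of the short geodesic. -/
lemma exists_mul_lengthOfTrace_close {ε : ℝ} (hε : 0 < ε) :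
    ∃ η > 0, ∀ E x d e₁ e₂ : ℝ, 0 < E → 2 < x → |x - 2| < η → |d| < η → |e₁| < η → |e₂| < η →
      (x - 2) * (E ^ 2 * ((1 + e₁) * (1 + e₂))) = x ^ 2 + d ^ 2 →
        |E * lengthOfTrace x - 4| < ε := by
  set F : ℝ × ℝ × ℝ × ℝ → ℝ := fun p =>
    √((p.1 + 2) * (p.1 ^ 2 + p.2.1 ^ 2) / ((1 + p.2.2.1) * (1 + p.2.2.2))) *
      dslope Real.arsinh 0 (√(p.1 ^ 2 - 4) / 2) with hF
  -- The limit constant is √(4 · 4) · arsinh'(0).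
  have hv : F (2, 0, 0, 0) = 4 := by
    have h1 : √(16 : ℝ) = 4 := by
      rw [show (16 : ℝ) = 4 ^ 2 by norm_num, Real.sqrt_sq (by norm_num)]
    have h2 : deriv Real.arsinh 0 = 1 := by
      rw [(Real.hasDerivAt_arsinh 0).deriv]
      simp
    simp only [hF]
    norm_num [h1, h2]
  have hcont : ContinuousAt F (2, 0, 0, 0) := by
    apply ContinuousAt.mul
    · apply ContinuousAt.sqrt
      apply ContinuousAt.div
      · fun_prop
      · fun_prop
      · norm_num
    · apply ContinuousAt.comp (g := dslope Real.arsinh 0)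
      · norm_num
        exact Real.differentiable_arsinh.differentiableAt
      · fun_prop
  obtain ⟨η, hη, h⟩ := Metric.continuousAt_iff.1 hcont ε hε
  refine ⟨min η 1, by positivity, fun E x d e₁ e₂ hE hx h1 h2 h3 h4 heq => ?_⟩
  simp only [lt_min_iff] at h1 h2 h3 h4
  have := h (x := (x, d, e₁, e₂)) (by
    simp only [Prod.dist_eq, Real.dist_eq, sub_zero, max_lt_iff]
    exact ⟨h1.1, h2.1, h3.1, h4.1⟩)
  rw [hv, Real.dist_eq] at this
  rw [mul_lengthOfTrace_eq hE hx (by linarith [(abs_lt.1 h3.2).1])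
    (by linarith [(abs_lt.1 h4.2).1]) heq]
  exact this

/-- With η = E⁻² ≤ 1, the error is at most (1 + 4η)(1 + η) − 1 ≤ 9η. -/
lemma near_two_mul_cosh {l c : ℝ} {n : ℕ} (hn : 0 < n) (hE : 2 ≤ Real.exp l) (hc : 1 ≤ c)
    (hc' : c ≤ 1 + 4 * (Real.exp l ^ 2)⁻¹) :
    Near (Real.exp l) 9 n (2 * c * Real.cosh (n * l)) := by
  set E := Real.exp l with hEdef
  have hE0 : 0 < E := by linarith
  have e : 2 * c * Real.cosh (n * l) = E ^ n * (1 + (c * (1 + (E ^ (2 * n))⁻¹) - 1)) := by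
    rw [Real.cosh_eq, Real.exp_neg, Real.exp_nat_mul, ← hEdef, two_mul n, pow_add]
    field_simp
    ring
  refine ⟨_, ?_, e⟩
  have h1 : (E ^ (2 * n))⁻¹ ≤ (E ^ 2)⁻¹ :=
    inv_anti₀ (by positivity) (pow_le_pow_right₀ (by linarith) (by omega))
  have h0 : 0 < (E ^ (2 * n))⁻¹ := by positivity
  have h2 : (E ^ 2)⁻¹ ≤ 1 := inv_le_one_of_one_le₀ (by nlinarith)
  rw [abs_of_nonneg (by nlinarith), div_eq_mul_inv]
  nlinarith

lemma cosh_div_sinh_le {l : ℝ} {n : ℕ} (hn : 0 < n) (hE : 2 ≤ Real.exp l) :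
    1 ≤ Real.cosh (n * l) / Real.sinh (n * l) ∧
      Real.cosh (n * l) / Real.sinh (n * l) ≤ 1 + 4 * (Real.exp l ^ 2)⁻¹ := by
  set E := Real.exp l with hEdef
  have hE0 : 0 < E := by linarith
  have h1 : (E ^ (2 * n))⁻¹ ≤ (E ^ 2)⁻¹ :=
    inv_anti₀ (by positivity) (pow_le_pow_right₀ (by linarith) (by omega))
  have h0 : 0 < (E ^ (2 * n))⁻¹ := by positivity
  have h2 : (E ^ 2)⁻¹ ≤ 1 / 4 := by
    rw [one_div]
    exact inv_anti₀ (by norm_num) (by nlinarith)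
  have hp : 0 < E ^ n := by positivity
  have ec : Real.cosh (n * l) = E ^ n / 2 * (1 + (E ^ (2 * n))⁻¹) := by
    rw [Real.cosh_eq, Real.exp_neg, Real.exp_nat_mul, ← hEdef, two_mul n, pow_add]
    field_simp
  have es : Real.sinh (n * l) = E ^ n / 2 * (1 - (E ^ (2 * n))⁻¹) := by
    rw [Real.sinh_eq, Real.exp_neg, Real.exp_nat_mul, ← hEdef, two_mul n, pow_add]
    field_simp
  rw [ec, es, mul_div_mul_left _ _ (by positivity)]
  constructor
  · rw [le_div_iff₀ (by linarith)]
    linarith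
  · rw [div_le_iff₀ (by linarith)]
    nlinarith

/-- Positivity of the right side of `h` gives x > 2; the upper bound comes from `hx`, whose two
squares are close to 1. -/
lemma trace_sub_two_bounds {E κ x e₁ e₂ e₃ : ℝ} (hE : 0 < E) (hκ : κ ≤ 1 / 100)
    (h₁ : |e₁| ≤ κ) (h₂ : |e₂| ≤ κ) (h₃ : |e₃| ≤ κ)
    (hx : x * (1 + e₃) = (1 + e₁) ^ 2 + (1 + e₂) ^ 2)
    (h : (x - 2) * (E ^ 2 * ((1 + e₁) * (1 + e₂))) = x ^ 2 + (E * (e₁ - e₂)) ^ 2) :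
    2 < x ∧ x - 2 ≤ 20 * κ := by
  have hκ0 : 0 ≤ κ := (abs_nonneg _).trans h₁
  obtain ⟨a₁, b₁⟩ := abs_le.1 h₁
  obtain ⟨a₂, b₂⟩ := abs_le.1 h₂
  obtain ⟨a₃, b₃⟩ := abs_le.1 h₃
  have hx0 : 1 < x := by
    by_contra! hlt
    nlinarith
  constructor
  · have p₁ : 0 < 1 + e₁ := by linarith
    have p₂ : 0 < 1 + e₂ := by linarith
    have hp : 0 < E ^ 2 * ((1 + e₁) * (1 + e₂)) := by positivity
    have : 0 < (x - 2) * (E ^ 2 * ((1 + e₁) * (1 + e₂))) := by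
      rw [h]
      positivity
    linarith [(mul_pos_iff_of_pos_right hp).1 this]
  · by_contra! hlt
    nlinarith

/-- A pair of generators close to `(E, E, E²)` yields the systole. -/
lemma exists_short_of_near {ε : ℝ} (hε : 0 < ε) (K : ℝ) :
    ∃ E₀ : ℝ, ∀ E, E₀ ≤ E → ∀ A B : SL(2, ℝ), tr ⁅A, B⁆ = -2 → Near E K 1 (tr A) →
      Near E K 1 (tr B) → Near E K 2 (tr (A * B)) →
      2 < tr (A * B⁻¹) ∧ |E * lengthOfTrace (tr (A * B⁻¹)) - 4| < ε ∧
        ∀ M ∈ Subgroup.closure {A, B}, |tr M| ≤ 2 ∨ tr (A * B⁻¹) ≤ |tr M| := by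
  obtain ⟨η, hη, hclose⟩ := exists_mul_lengthOfTrace_close hε
  set C := |K| + 1 with hC
  have hC1 : 1 ≤ C := by linarith [abs_nonneg K]
  refine ⟨max 100 (max (100 * C) (100 * C / η)), fun E hE A B hc h₁ h₂ h₃ => ?_⟩
  have hE1 : 100 ≤ E := (le_max_left _ _).trans hE
  have hE2 : 100 * C ≤ E := (le_max_left _ _).trans ((le_max_right _ _).trans hE)
  have hE3 : 100 * C / η ≤ E := (le_max_right _ _).trans ((le_max_right _ _).trans hE)
  have hE0 : 0 < E := by linarith
  have hKC : K ≤ C := by linarith [le_abs_self K]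
  obtain ⟨e₁, he₁, h₁⟩ := h₁.mono hKC
  obtain ⟨e₂, he₂, h₂⟩ := h₂.mono hKC
  obtain ⟨e₃, he₃, h₃⟩ := h₃.mono hKC
  -- κ bounds the relative errors, while μ = Eκ controls the absolute difference tr A − tr B, which
  -- must also become small.
  obtain ⟨κ, hκ⟩ : ∃ κ, κ = C / E ^ 2 := ⟨_, rfl⟩
  obtain ⟨μ, hμ⟩ : ∃ μ, μ = C / E := ⟨_, rfl⟩
  rw [← hκ] at he₁ he₂ he₃
  have hμ0 : 0 < μ := by rw [hμ]; positivity
  have hμ1 : μ ≤ 1 / 100 := by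
    rw [hμ, div_le_iff₀ hE0]
    linarith
  have hμη : 100 * μ ≤ η := by
    rw [div_le_iff₀ hη] at hE3
    rw [hμ, mul_div_assoc', div_le_iff₀ hE0]
    linarith
  have hκμ : E * κ = μ := by
    rw [hκ, hμ]
    field_simp
  have hκ0 : 0 < κ := by rw [hκ]; positivity
  have hκle : 100 * κ ≤ μ := by
    rw [← hκμ]
    exact mul_le_mul_of_nonneg_right hE1 hκ0.le
  rw [pow_one] at h₁ h₂
  have hx : tr (A * B⁻¹) * (1 + e₃) = (1 + e₁) ^ 2 + (1 + e₂) ^ 2 := by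
    have hx3 := tr_mul_inv_mul hc
    rw [h₁, h₂, h₃] at hx3
    apply mul_left_cancel₀ (by positivity : E ^ 2 ≠ 0)
    linear_combination hx3
  have hmain : (tr (A * B⁻¹) - 2) * (E ^ 2 * ((1 + e₁) * (1 + e₂))) =
      tr (A * B⁻¹) ^ 2 + (E * (e₁ - e₂)) ^ 2 := by
    have : (tr (A * B⁻¹) - 2) * (tr A * tr B) = tr (A * B⁻¹) ^ 2 + (tr A - tr B) ^ 2 := by
      rw [tr_mul_inv]
      linear_combination -markoff_of_tr_commutator hc
    rw [h₁, h₂] at this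
    linear_combination this
  obtain ⟨hx2, hxle⟩ := trace_sub_two_bounds hE0 (by linarith) he₁ he₂ he₃ hx hmain
  have hd : |E * (e₁ - e₂)| ≤ 2 * μ := by
    rw [abs_mul, abs_of_pos hE0, ← hκμ]
    have : |e₁ - e₂| ≤ 2 * κ := (abs_sub _ _).trans (by linarith)
    linarith [mul_le_mul_of_nonneg_left this hE0.le]
  refine ⟨hx2, ?_, ?_⟩
  · refine hclose E _ (E * (e₁ - e₂)) e₁ e₂ hE0 hx2 ?_ ?_ ?_ ?_ hmain
    · rw [abs_of_pos (by linarith)]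
      linarith
    · linarith
    · linarith
    · linarith
  · intro M hM
    -- In the generators AB⁻¹, B the trace triple is (tr(AB⁻¹), tr B, tr A).
    rw [← closure_mul_inv_pair] at hM
    have eAB : tr (A * B⁻¹ * B) = tr A := by rw [inv_mul_cancel_right]
    have half : ∀ e : ℝ, |e| ≤ κ → 36 ≤ E * (1 + e) := by
      intro e he
      have : 1 / 2 ≤ 1 + e := by linarith [(abs_le.1 he).1]
      linarith [mul_le_mul_of_nonneg_left this hE0.le]
    refine abs_tr_of_short (tr_commutator_mul_inv hc) hx2 (by linarith) ?_ ?_ ?_ hM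
    · rw [h₂]
      exact half _ he₂
    · rw [eAB, h₁]
      exact half _ he₁
    · have e : tr (A * B⁻¹ * B) - tr B = E * (e₁ - e₂) := by
        rw [eAB, h₁, h₂]
        ring
      rw [e, ← sq_abs]
      have h1 : |E * (e₁ - e₂)| ≤ 1 / 2 := by linarith
      have := pow_le_pow_left₀ (abs_nonneg _) h1 2
      linarith

/-! ### Assembly. -/

/-- The systole in terms of the Fenchel–Nielsen coordinates. -/
theorem exists_sys_close {γ δ : Pi1} (hγδ : MeetOnce γ δ) {p q : ℕ} (hp : 0 < p) (hpq : p < q)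
    (hcop : Nat.gcd p q = 1) {ε : ℝ} (hε : 0 < ε) :
    ∃ L₀ : ℝ, ∀ (X : Teich) (L : ℝ), L₀ ≤ L → HasFenchelNielsen γ δ X L ((p : ℝ) / (q : ℝ)) →
      |X.sys * Real.exp (L / (2 * q)) - 4| < ε := by
  have hq : 0 < q := hp.trans hpq
  have hq0 : (0 : ℝ) < q := by exact_mod_cast hq
  obtain ⟨K', E₀, hE₀⟩ := exists_reduced_pair (q + p) q p rfl hq hp
    (by rw [Nat.coprime_comm]; exact hcop) 9
  obtain ⟨E₁, hE₁⟩ := exists_short_of_near hε K'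
  refine ⟨2 * q * Real.log (max 2 (max E₀ E₁)), fun X L hL hX => ?_⟩
  set l := L / (2 * q) with hl
  have hmax : (0 : ℝ) < max 2 (max E₀ E₁) := lt_of_lt_of_le two_pos (le_max_left _ _)
  have hEl : max 2 (max E₀ E₁) ≤ Real.exp l := by
    rw [← Real.log_le_iff_le_exp hmax, hl, le_div_iff₀ (by positivity)]
    linarith
  have hE2 : 2 ≤ Real.exp l := (le_max_left _ _).trans hEl
  have hE0 : E₀ ≤ Real.exp l := (le_max_left _ _).trans ((le_max_right _ _).trans hEl)
  have hE1 : E₁ ≤ Real.exp l := (le_max_right _ _).trans ((le_max_right _ _).trans hEl)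
  obtain ⟨A, B, hA, hB, tA, tB, tAB⟩ := hX.traces hγδ
  have a1 : L / 2 = q * l := by rw [hl]; field_simp
  have a2 : (p : ℝ) / q * L / 2 = p * l := by rw [hl]; field_simp
  have a3 : ((p : ℝ) / q * L + L) / 2 = (q + p : ℕ) * l := by
    push_cast
    linear_combination a1 + a2
  rw [a1] at tA tB tAB
  rw [a2] at tB
  rw [a3] at tAB
  obtain ⟨c1, c2⟩ := cosh_div_sinh_le hq hE2
  have hcomm : tr ⁅A, B⁆ = -2 := by
    have := X.tr_commutator_eq hγδ
    rw [tr_commutator] at this ⊢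
    rcases hA with hA | hA <;> rcases hB with hB | hB <;> rw [hA, hB] at this <;>
      first
        | linarith
        | (simp only [neg_mul, mul_neg, tr_neg, neg_neg] at this; linarith)
  obtain ⟨A', B', hcl, hc', nA, nB, nAB⟩ := hE₀ _ hE0 A B hcomm
    (by
      have := near_two_mul_cosh (c := 1) hq hE2 le_rfl (by
        have : 0 < (Real.exp l ^ 2)⁻¹ := by positivity
        linarith)
      rw [tA]
      simpa using this)
    (by rw [tB]; exact near_two_mul_cosh hp hE2 c1 c2)
    (by rw [tAB]; exact near_two_mul_cosh (by omega) hE2 c1 c2)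
  obtain ⟨hx, hclose, hmin⟩ := hE₁ _ hE1 A' B' hc' nA nB nAB
  obtain ⟨⟨b, rfl, rfl⟩, -⟩ := hγδ
  have habs : ∀ w, |tr (pairHom (X.hol (b 0)) (X.hol (b 1)) w)| = |tr (pairHom A B w)| := by
    intro w
    rcases pairHom_eq_or_eq_neg hA hB w with e | e <;> rw [e]
    rw [tr_neg, abs_neg]
  have hsys : X.sys = lengthOfTrace (tr (A' * B'⁻¹)) := by
    refine X.sys_eq hx ?_ ?_
    · have hmem : A' * B'⁻¹ ∈ (pairHom A B).range := by
        rw [range_pairHom, ← hcl]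
        exact mul_mem (Subgroup.subset_closure (by simp))
          (inv_mem (Subgroup.subset_closure (by simp)))
      obtain ⟨w, hw⟩ := hmem
      refine ⟨b.repr.symm w, ?_⟩
      rw [X.hol_eq_pairHom b, MulEquiv.apply_symm_apply, habs, hw, abs_of_pos (by linarith)]
    · intro g
      rw [X.hol_eq_pairHom b, habs]
      apply hmin
      rw [hcl, ← range_pairHom]
      exact ⟨_, rfl⟩
  rw [hsys, mul_comm]
  exact hclose

lemma Teich.sys_nonneg (X : Teich) : 0 ≤ X.sys := by
  apply Real.sInf_nonneg
  rintro _ ⟨g, -, rfl⟩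
  exact Real.iInf_nonneg fun z => dist_nonneg

lemma Teich.sys_le_len (X : Teich) {γ δ : Pi1} (h : MeetOnce γ δ) : X.sys ≤ X.len γ := by
  refine csInf_le ⟨0, ?_⟩ ⟨γ, ?_, rfl⟩
  · rintro _ ⟨g, -, rfl⟩
    exact Real.iInf_nonneg fun z => dist_nonneg
  · rw [isHyperbolic_iff, trace_eq_tr]
    exact X.four_lt_sq_tr h

end PuncturedTorus

theorem proposition2p1 (γ δ : PuncturedTorus.Pi1) (hγδ : PuncturedTorus.MeetOnce γ δ)
    (p q : ℕ) (hp : 0 < p) (hpq : p < q) (hcop : Nat.gcd p q = 1) :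
    ∃ C₁ C₂ : ℝ → ℝ, Tendsto C₁ atTop (𝓝 4) ∧ Tendsto C₂ atTop (𝓝 4) ∧
      ∀ (X : PuncturedTorus.Teich) (L : ℝ),
        PuncturedTorus.HasFenchelNielsen γ δ X L ((p : ℝ) / (q : ℝ)) →
          C₁ L * Real.exp (-L / (2 * (q : ℝ))) < X.sys ∧
            X.sys < C₂ L * Real.exp (-L / (2 * (q : ℝ))) := by
  -- The worst deviation from 4 over all structures with the given L serves as the error term of
  -- both functions; `hbdd`, from sys ≤ L, makes its supremum meaningful.
  set S : ℝ → Set ℝ := fun L => {r | ∃ X, PuncturedTorus.HasFenchelNielsen γ δ X L (p / q) ∧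
    r = |X.sys * Real.exp (L / (2 * q)) - 4|} with hS
  have hbdd : ∀ L, BddAbove (S L) := by
    intro L
    refine ⟨L * Real.exp (L / (2 * q)) + 4, ?_⟩
    rintro _ ⟨X, hX, rfl⟩
    have h0 := X.sys_nonneg
    have h1 := X.sys_le_len hγδ
    rw [hX.1] at h1
    have h2 := mul_le_mul_of_nonneg_right h1 (Real.exp_pos (L / (2 * q))).le
    have h3 := mul_nonneg h0 (Real.exp_pos (L / (2 * q))).le
    rw [abs_le]
    constructor <;> linarith
  have hnonneg : ∀ L, 0 ≤ sSup (S L) := by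
    intro L
    apply Real.sSup_nonneg
    rintro _ ⟨X, -, rfl⟩
    exact abs_nonneg _
  have hlim : Tendsto (fun L => sSup (S L)) atTop (𝓝 0) := by
    rw [Metric.tendsto_atTop]
    intro ε hε
    obtain ⟨L₀, hL₀⟩ := PuncturedTorus.exists_sys_close hγδ hp hpq hcop (half_pos hε)
    refine ⟨L₀, fun L hL => ?_⟩
    rw [Real.dist_eq, sub_zero, abs_of_nonneg (hnonneg L)]
    refine lt_of_le_of_lt (Real.sSup_le ?_ (half_pos hε).le) (half_lt_self hε)
    rintro _ ⟨X, hX, rfl⟩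
    exact (hL₀ X L hL hX).le
  have hexp : Tendsto (fun L : ℝ => Real.exp (-L)) atTop (𝓝 0) :=
    Real.tendsto_exp_neg_atTop_nhds_zero
  -- The extra exp(−L) makes both inequalities strict without changing the limits.
  refine ⟨fun L => 4 - sSup (S L) - Real.exp (-L), fun L => 4 + sSup (S L) + Real.exp (-L),
    ?_, ?_, ?_⟩
  · simpa using (tendsto_const_nhds.sub hlim).sub hexp
  · simpa using (tendsto_const_nhds.add hlim).add hexp
  · intro X L hX
    have hle : |X.sys * Real.exp (L / (2 * q)) - 4| ≤ sSup (S L) :=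
      le_csSup (hbdd L) ⟨X, hX, rfl⟩
    obtain ⟨h1, h2⟩ := abs_le.1 hle
    have h3 := Real.exp_pos (-L)
    have e : Real.exp (-L / (2 * q)) = (Real.exp (L / (2 * q)))⁻¹ := by
      rw [neg_div, Real.exp_neg]
    rw [e, ← div_eq_mul_inv, ← div_eq_mul_inv, div_lt_iff₀ (Real.exp_pos _),
      lt_div_iff₀ (Real.exp_pos _)]
    constructor <;> linarith
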